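/- Proposition 2. Let $M$ be a smooth (Hausdorff, second countable) manifold and let $n\ge 0$. Let $\mathcal G_n$ be the constant sheaf on $M$ with values in $GL(n,\mathbb R)$, whose sections over an open set $W$ are the locally constant functions $W\to GL(n,\mathbb R)$. For an open cover $\mathcal U=\{U_\alpha\}_{\alpha\in A}$ of $M$, a 1-cocycle is a family $t_{\alpha\beta}\in\mathcal G_n(U_\alpha\cap U_\beta)$ with $t_{\alpha\gamma}^{-1}t_{\alpha\beta}t_{\beta\gamma}=1$ on $U_\alpha\cap U_\beta\cap U_\gamma$. Two 1-cocycles $t,t'$ on $\mathcal U$ are cohomologous if $t'_{\alpha\beta}=b_\alpha^{-1}t_{\alpha\beta}b_\beta$ for some family $b_\alpha\in\mathcal G_n(U_\alpha)$. Let $\check H^1(\mathcal U,\mathcal G_n)$ be the set of cohomology classes of 1-cocycles on $\mathcal U$, and let $H^1(M,\mathcal G_n)=\varinjlim_{\mathcal U}\check H^1(\mathcal U,\mathcal G_n)$, the limit being over open covers ordered by refinement. It is a pointed set whose distinguished element $1$ is the class of the identity cocycle. Let $E\to M$ be a smooth real vector bundle of rank $n$ with a smooth flat connection $\nabla$ (that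 is, with vanishing curvature), and let $\xi$ be the isomorphism class of $(E,\nabla)$; isomorphisms are smooth vector bundle isomorphisms over $\mathrm{id}_M$ that intertwine the connections. For a representative $(E',\nabla')$ of $\xi$, an open cover $\{U_\alpha\}$ of $M$ and smooth frames $(h_{\alpha 1},\dots,h_{\alpha n})$ of $E'|_{U_\alpha}$ consisting of $\nabla'$-parallel sections, the transition cocycle $t$ is given by $h_{\alpha i}=\sum_j (t_{\alpha\beta})_{ij}h_{\beta j}$ on $U_\alpha\cap U_\beta$. Let $\Theta(\xi)\in H^1(M,\mathcal G_n)$ be the class of such a transition cocycle. Then $\Theta(\xi)$ is well defined: such transition cocycles exist, and they all have the same class in $H^1(M,\mathcal G_n)$, whatever the representative, the cover and the frames. Moreover, there exists a global frame $(s_1,\dots,s_n)$ of $E$ over $M$ consisting of smooth parallel sections if and only if $\Theta(\xi)=1$. -/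

import Mathlib

open Bundle TopologicalSpace
open scoped Manifold ContDiff

universe u v

noncomputable section

/-! ## Nonabelian Čech cohomology of the constant sheaf with values in `GL(n, ℝ)` -/

namespace FlatCech

/-- Sections over the open set `W` of the constant sheaf with values in `GL(n, ℝ)`,
i.e. locally constant functions on `W`. -/
abbrev Sec {M : Type u} [TopologicalSpace M] (n : ℕ) (W : Opens M) : Type u :=
  LocallyConstant W (GL (Fin n) ℝ)

/-- Restriction of sections to a smaller open set. -/
def Sec.res {M : Type u} [TopologicalSpace M] {n : ℕ} {V W : Opens M} (h : V ≤ W)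
    (s : Sec n W) : Sec n V :=
  LocallyConstant.comap ⟨Opens.inclusion h, continuous_inclusion h⟩ s

@[simp]
theorem Sec.res_apply {M : Type u} [TopologicalSpace M] {n : ℕ} {V W : Opens M} (h : V ≤ W)
    (s : Sec n W) (x : V) : s.res h x = s ⟨x.1, h x.2⟩ := rfl

/-- An open cover `{U_α : α ∈ A}` of `M`. -/
structure OpenCover (M : Type u) [TopologicalSpace M] where
  /-- the index set -/
  A : Type u
  /-- the members of the cover -/
  U : A → Opens M
  covers : ∀ x : M, ∃ α, x ∈ U α

section Complex

variable {M : Type u} [TopologicalSpace M] (𝒰 : OpenCover M) (n : ℕ)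

/-- Čech 0-cochains. -/
abbrev C0 : Type u := ∀ α : 𝒰.A, Sec n (𝒰.U α)

/-- Čech 1-cochains. -/
abbrev C1 : Type u := ∀ α β : 𝒰.A, Sec n (𝒰.U α ⊓ 𝒰.U β)

/-- Čech 2-cochains. -/
abbrev C2 : Type u := ∀ α β γ : 𝒰.A, Sec n (𝒰.U α ⊓ 𝒰.U β ⊓ 𝒰.U γ)

variable {𝒰 n}

/-- `(δ⁰ a)_{αβ} = a_α⁻¹ a_β`. -/
def d0 (a : C0 𝒰 n) : C1 𝒰 n := fun α β =>
  ((a α).res inf_le_left)⁻¹ * (a β).res inf_le_right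

/-- `(δ¹ a)_{αβγ} = a_{αγ}⁻¹ a_{αβ} a_{βγ}`. -/
def d1 (a : C1 𝒰 n) : C2 𝒰 n := fun α β γ =>
  ((a α γ).res (le_inf (inf_le_left.trans inf_le_left) inf_le_right))⁻¹ *
    (a α β).res inf_le_left *
    (a β γ).res (le_inf (inf_le_left.trans inf_le_right) inf_le_right)

variable (𝒰 n) in
/-- Čech 1-cocycles: 1-cochains `a` with `δ¹ a = 1`. -/
def Z1 : Type u := {a : C1 𝒰 n // d1 a = 1}

theorem d1_eq_one_iff (a : C1 𝒰 n) : d1 a = 1 ↔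
    ∀ (α β γ : 𝒰.A) (x : M) (hα : x ∈ 𝒰.U α) (hβ : x ∈ 𝒰.U β) (hγ : x ∈ 𝒰.U γ),
      a α β ⟨x, hα, hβ⟩ * a β γ ⟨x, hβ, hγ⟩ = a α γ ⟨x, hα, hγ⟩ := by
  constructor
  · intro h α β γ x hα hβ hγ
    have h1 : d1 a α β γ ⟨x, ⟨hα, hβ⟩, hγ⟩ = 1 := by rw [h]; rfl
    have h2 : (a α γ ⟨x, hα, hγ⟩)⁻¹ * a α β ⟨x, hα, hβ⟩ * a β γ ⟨x, hβ, hγ⟩ = 1 := h1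
    rw [mul_assoc, inv_mul_eq_one] at h2
    exact h2.symm
  · intro h
    funext α β γ
    ext1 ⟨x, ⟨hα, hβ⟩, hγ⟩
    change (a α γ ⟨x, hα, hγ⟩)⁻¹ * a α β ⟨x, hα, hβ⟩ * a β γ ⟨x, hβ, hγ⟩ = 1
    rw [mul_assoc, inv_mul_eq_one]
    exact (h α β γ x hα hβ hγ).symm

instance : One (Z1 𝒰 n) where
  one := ⟨1, (d1_eq_one_iff _).2 fun _ _ _ _ _ _ _ => mul_one _⟩

/-- `a ∼ a'` iff `a'_{αβ} = b_α⁻¹ a_{αβ} b_β` for some 0-cochain `b`. -/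
def Cohomologous (a a' : Z1 𝒰 n) : Prop :=
  ∃ b : C0 𝒰 n, ∀ α β : 𝒰.A,
    a'.1 α β = ((b α).res inf_le_left)⁻¹ * a.1 α β * (b β).res inf_le_right

theorem cohomologous_iff (a a' : Z1 𝒰 n) : Cohomologous a a' ↔
    ∃ b : C0 𝒰 n, ∀ (α β : 𝒰.A) (x : M) (hα : x ∈ 𝒰.U α) (hβ : x ∈ 𝒰.U β),
      a'.1 α β ⟨x, hα, hβ⟩ = (b α ⟨x, hα⟩)⁻¹ * a.1 α β ⟨x, hα, hβ⟩ * b β ⟨x, hβ⟩ := by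
  refine exists_congr fun b => ⟨fun h α β x hα hβ => ?_, fun h α β => ?_⟩
  · rw [h α β]; rfl
  · ext1 ⟨x, hα, hβ⟩
    exact h α β x hα hβ

variable (𝒰 n) in
instance cohomologousSetoid : Setoid (Z1 𝒰 n) where
  r := Cohomologous
  iseqv :=
    { refl := fun a => (cohomologous_iff a a).2 ⟨1, fun α β x hα hβ => by simp⟩
      symm := by
        intro a a' h
        obtain ⟨b, hb⟩ := (cohomologous_iff _ _).1 h
        refine (cohomologous_iff _ _).2 ⟨b⁻¹, fun α β x hα hβ => ?_⟩
        rw [hb α β x hα hβ]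
        simp [mul_assoc]
      trans := by
        intro a a' a'' h h'
        obtain ⟨b, hb⟩ := (cohomologous_iff _ _).1 h
        obtain ⟨c, hc⟩ := (cohomologous_iff _ _).1 h'
        refine (cohomologous_iff _ _).2 ⟨b * c, fun α β x hα hβ => ?_⟩
        rw [hc α β x hα hβ, hb α β x hα hβ]
        simp [mul_assoc] }

variable (𝒰 n) in
/-- The first cohomology set of the Čech complex of the cover `𝒰`. -/
def CechH1 : Type u := Quotient (cohomologousSetoid 𝒰 n)

end Complex

section Refinement

variable {M : Type u} [TopologicalSpace M] {n : ℕ}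

/-- A refinement map exhibiting `𝒱` as a refinement of `𝒰`. -/
structure Refinement (𝒱 𝒰 : OpenCover M) where
  ρ : 𝒱.A → 𝒰.A
  le : ∀ α, 𝒱.U α ≤ 𝒰.U (ρ α)

/-- Composition of refinement maps. -/
def Refinement.comp {𝒲 𝒱 𝒰 : OpenCover M} (s : Refinement 𝒲 𝒱) (r : Refinement 𝒱 𝒰) :
    Refinement 𝒲 𝒰 where
  ρ := r.ρ ∘ s.ρ
  le α := (s.le α).trans (r.le _)

/-- A common refinement of two covers. -/
def OpenCover.inf (𝒰 𝒰' : OpenCover M) : OpenCover M where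
  A := 𝒰.A × 𝒰'.A
  U p := 𝒰.U p.1 ⊓ 𝒰'.U p.2
  covers x := by
    obtain ⟨α, hα⟩ := 𝒰.covers x
    obtain ⟨β, hβ⟩ := 𝒰'.covers x
    exact ⟨(α, β), hα, hβ⟩

/-- The common refinement refines the first cover. -/
def OpenCover.infLeft (𝒰 𝒰' : OpenCover M) : Refinement (𝒰.inf 𝒰') 𝒰 :=
  ⟨Prod.fst, fun _ => inf_le_left⟩

/-- The common refinement refines the second cover. -/
def OpenCover.infRight (𝒰 𝒰' : OpenCover M) : Refinement (𝒰.inf 𝒰') 𝒰' :=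
  ⟨Prod.snd, fun _ => inf_le_right⟩

/-- Restriction of cocycles along a refinement: `(r^* t)_{αβ} = t_{ρ(α) ρ(β)}` restricted to
`V_α ∩ V_β`. -/
def Refinement.pull {𝒱 𝒰 : OpenCover M} (r : Refinement 𝒱 𝒰) (t : Z1 𝒰 n) : Z1 𝒱 n :=
  ⟨fun α β => (t.1 (r.ρ α) (r.ρ β)).res (inf_le_inf (r.le α) (r.le β)),
    (d1_eq_one_iff _).2 fun α β γ _ hα hβ hγ =>
      (d1_eq_one_iff _).1 t.2 _ _ _ _ (r.le α hα) (r.le β hβ) (r.le γ hγ)⟩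

/-- The map on first cohomology sets induced by a refinement. -/
def Refinement.map {𝒱 𝒰 : OpenCover M} (r : Refinement 𝒱 𝒰) : CechH1 𝒰 n → CechH1 𝒱 n :=
  Quotient.map r.pull (by
    intro a a' h
    obtain ⟨b, hb⟩ := (cohomologous_iff _ _).1 h
    exact (cohomologous_iff _ _).2
      ⟨fun α => (b (r.ρ α)).res (r.le α), fun α β x hα hβ => hb _ _ x (r.le α hα) (r.le β hβ)⟩)

theorem Refinement.map_comp {𝒲 𝒱 𝒰 : OpenCover M} (s : Refinement 𝒲 𝒱) (r : Refinement 𝒱 𝒰)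
    (c : CechH1 𝒰 n) : (s.comp r).map c = s.map (r.map c) := by
  induction c using Quotient.inductionOn
  rfl

/-- The induced map does not depend on the choice of the refinement map. -/
theorem Refinement.map_eq {𝒱 𝒰 : OpenCover M} (r s : Refinement 𝒱 𝒰)
    (c : CechH1 𝒰 n) : r.map c = s.map c := by
  induction c using Quotient.inductionOn with
  | h t =>
    refine Quotient.sound ((cohomologous_iff _ _).2
      ⟨fun α => (t.1 (r.ρ α) (s.ρ α)).res (le_inf (r.le α) (s.le α)), fun α β x hα hβ => ?_⟩)
    have ht := (d1_eq_one_iff _).1 t.2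
    have h1 := ht (r.ρ α) (r.ρ β) (s.ρ β) x (r.le α hα) (r.le β hβ) (s.le β hβ)
    have h2 := ht (r.ρ α) (s.ρ α) (s.ρ β) x (r.le α hα) (s.le α hα) (s.le β hβ)
    change t.1 (s.ρ α) (s.ρ β) ⟨x, s.le α hα, s.le β hβ⟩ =
      (t.1 (r.ρ α) (s.ρ α) ⟨x, r.le α hα, s.le α hα⟩)⁻¹ *
        t.1 (r.ρ α) (r.ρ β) ⟨x, r.le α hα, r.le β hβ⟩ *
        t.1 (r.ρ β) (s.ρ β) ⟨x, r.le β hβ, s.le β hβ⟩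
    rw [mul_assoc, h1, ← h2, inv_mul_cancel_left]

end Refinement

section Limit

variable (M : Type u) [TopologicalSpace M] (n : ℕ)

/-- Two classes on two covers are identified in the direct limit iff they agree on some common
refinement. -/
instance limitSetoid : Setoid (Σ 𝒰 : OpenCover M, CechH1 𝒰 n) where
  r p q := ∃ (𝒱 : OpenCover M) (r : Refinement 𝒱 p.1) (s : Refinement 𝒱 q.1),
    r.map p.2 = s.map q.2
  iseqv :=
    { refl := fun p => ⟨p.1, ⟨id, fun _ => le_rfl⟩, ⟨id, fun _ => le_rfl⟩, rfl⟩
      symm := fun ⟨𝒱, r, s, h⟩ => ⟨𝒱, s, r, h.symm⟩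
      trans := by
        rintro p q w ⟨𝒱, r, s, h⟩ ⟨𝒱', r', s', h'⟩
        refine ⟨𝒱.inf 𝒱', (𝒱.infLeft 𝒱').comp r, (𝒱.infRight 𝒱').comp s', ?_⟩
        rw [Refinement.map_comp, h, ← Refinement.map_comp, Refinement.map_comp _ s', ← h',
          ← Refinement.map_comp]
        exact Refinement.map_eq _ _ _ }

/-- `H¹(M, 𝒢_n)`: the direct limit of the first Čech cohomology sets over all open covers. -/
def H1 : Type (u + 1) := Quotient (limitSetoid M n)

variable {M n}

/-- The class in `H¹(M, 𝒢_n)` of a 1-cocycle on an open cover. -/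
def H1.mk (𝒰 : OpenCover M) (t : Z1 𝒰 n) : H1 M n :=
  Quotient.mk (limitSetoid M n) ⟨𝒰, Quotient.mk (cohomologousSetoid 𝒰 n) t⟩

variable (M) in
/-- The open cover consisting of `M` alone. -/
def OpenCover.trivial : OpenCover M where
  A := PUnit
  U _ := ⊤
  covers _ := ⟨PUnit.unit, _root_.trivial⟩

/-- The distinguished element of `H¹(M, 𝒢_n)`: the class of the identity cocycle. -/
instance : One (H1 M n) where
  one := H1.mk (OpenCover.trivial M) 1

/-- The identity cocycle of any cover represents the distinguished element. -/
theorem H1.mk_one (𝒰 : OpenCover M) : H1.mk 𝒰 (1 : Z1 𝒰 n) = 1 :=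
  Quotient.sound ⟨𝒰, ⟨id, fun _ => le_rfl⟩, ⟨fun _ => PUnit.unit, fun _ _ _ => _root_.trivial⟩, rfl⟩

end Limit

end FlatCech

/-! ## Flat vector bundles -/

/-- A connection is flat when its curvature
`R(X, Y)σ = ∇_X ∇_Y σ - ∇_Y ∇_X σ - ∇_{[X, Y]} σ` vanishes, for all smooth vector fields `X`, `Y`
and all smooth sections `σ`. -/
def CovariantDerivative.IsFlat {m : ℕ} {M : Type u} [TopologicalSpace M]
    [ChartedSpace (EuclideanSpace ℝ (Fin m)) M]
    {F : Type*} [NormedAddCommGroup F] [NormedSpace ℝ F]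
    {V : M → Type v} [TopologicalSpace (TotalSpace F V)]
    [∀ x, AddCommGroup (V x)] [∀ x, Module ℝ (V x)] [∀ x, TopologicalSpace (V x)]
    [∀ x, IsTopologicalAddGroup (V x)] [∀ x, ContinuousSMul ℝ (V x)]
    [FiberBundle F V] [IsManifold (𝓡 m) 1 M]
    (cov : CovariantDerivative (𝓡 m) F V) : Prop :=
  ∀ (X Y : Π x : M, TangentSpace (𝓡 m) x) (σ : Π x : M, V x),
    ContMDiff (𝓡 m) (𝓡 m).tangent ∞ (T% X) → ContMDiff (𝓡 m) (𝓡 m).tangent ∞ (T% Y) →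
    ContMDiff (𝓡 m) ((𝓡 m).prod 𝓘(ℝ, F)) ∞ (T% σ) → ∀ x : M,
      cov (fun y => cov σ y (Y y)) x (X x) - cov (fun y => cov σ y (X y)) x (Y x)
        - cov σ x (VectorField.mlieBracket (𝓡 m) X Y x) = 0

/-- A pair `(E, ∇)` of a smooth real vector bundle of rank `n` over `M` and a smooth flat
connection on it. -/
structure FlatBundle (m : ℕ) (M : Type u) [TopologicalSpace M]
    [ChartedSpace (EuclideanSpace ℝ (Fin m)) M] [IsManifold (𝓡 m) ∞ M] (n : ℕ) where
  /-- the fibres -/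
  fiber : M → Type v
  [topTotal : TopologicalSpace (TotalSpace (EuclideanSpace ℝ (Fin n)) fiber)]
  [addCommGroup : ∀ x, AddCommGroup (fiber x)]
  [module : ∀ x, Module ℝ (fiber x)]
  [topFiber : ∀ x, TopologicalSpace (fiber x)]
  [topAddGroup : ∀ x, IsTopologicalAddGroup (fiber x)]
  [contSMul : ∀ x, ContinuousSMul ℝ (fiber x)]
  [fiberBundle : FiberBundle (EuclideanSpace ℝ (Fin n)) fiber]
  [vectorBundle : VectorBundle ℝ (EuclideanSpace ℝ (Fin n)) fiber]
  [smoothBundle : ContMDiffVectorBundle ∞ (EuclideanSpace ℝ (Fin n)) fiber (𝓡 m)]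
  /-- the connection -/
  conn : CovariantDerivative (𝓡 m) (EuclideanSpace ℝ (Fin n)) fiber
  smooth : CovariantDerivative.ContMDiffCovariantDerivative conn ∞
  flat : conn.IsFlat

namespace FlatBundle

attribute [instance] topTotal addCommGroup module topFiber topAddGroup contSMul fiberBundle
  vectorBundle smoothBundle

variable {m : ℕ} {M : Type u} [TopologicalSpace M]
  [ChartedSpace (EuclideanSpace ℝ (Fin m)) M] [IsManifold (𝓡 m) ∞ M] {n : ℕ}

/-- The total space of the bundle. -/
abbrev Total (E : FlatBundle.{u, v} m M n) : Type (max u v) :=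
  TotalSpace (EuclideanSpace ℝ (Fin n)) E.fiber

/-- A section, seen as a map from `M` to the total space. -/
abbrev toTotal (E : FlatBundle.{u, v} m M n) (σ : Π x : M, E.fiber x) : M → E.Total :=
  fun x => ⟨x, σ x⟩

/-- An isomorphism of flat bundles: a smooth isomorphism of vector bundles over the identity
of `M` that intertwines the connections. -/
structure Iso (E E' : FlatBundle.{u, v} m M n) where
  /-- the fibrewise linear isomorphisms -/
  equiv : ∀ x : M, E.fiber x ≃ₗ[ℝ] E'.fiber x
  smooth_toFun : ContMDiff ((𝓡 m).prod 𝓘(ℝ, EuclideanSpace ℝ (Fin n)))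
    ((𝓡 m).prod 𝓘(ℝ, EuclideanSpace ℝ (Fin n))) ∞
    (fun p : E.Total => (⟨p.1, equiv p.1 p.2⟩ : E'.Total))
  smooth_invFun : ContMDiff ((𝓡 m).prod 𝓘(ℝ, EuclideanSpace ℝ (Fin n)))
    ((𝓡 m).prod 𝓘(ℝ, EuclideanSpace ℝ (Fin n))) ∞
    (fun p : E'.Total => (⟨p.1, (equiv p.1).symm p.2⟩ : E.Total))
  map_conn : ∀ (σ : Π x : M, E.fiber x) (x : M),
    MDifferentiableAt (𝓡 m) ((𝓡 m).prod 𝓘(ℝ, EuclideanSpace ℝ (Fin n))) (E.toTotal σ) x →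
    ∀ v : TangentSpace (𝓡 m) x,
      E'.conn (fun y => equiv y (σ y)) x v = equiv x (E.conn σ x v)

instance isoSetoid (m : ℕ) (M : Type u) [TopologicalSpace M]
    [ChartedSpace (EuclideanSpace ℝ (Fin m)) M] [IsManifold (𝓡 m) ∞ M] (n : ℕ) :
    Setoid (FlatBundle.{u, v} m M n) where
  r E E' := Nonempty (Iso E E')
  iseqv :=
    { refl := fun E => ⟨⟨fun _ => LinearEquiv.refl ℝ _, contMDiff_id, contMDiff_id,
        fun _ _ _ _ => rfl⟩⟩
      symm := by
        rintro E E' ⟨φ⟩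
        refine ⟨⟨fun x => (φ.equiv x).symm, φ.smooth_invFun, φ.smooth_toFun, ?_⟩⟩
        intro σ x hσ v
        have h1 : MDifferentiableAt (𝓡 m) ((𝓡 m).prod 𝓘(ℝ, EuclideanSpace ℝ (Fin n)))
            (E.toTotal (fun y => (φ.equiv y).symm (σ y))) x :=
          MDifferentiableAt.comp (I' := (𝓡 m).prod 𝓘(ℝ, EuclideanSpace ℝ (Fin n))) x
            ((φ.smooth_invFun.mdifferentiable (by simp)) (⟨x, σ x⟩ : E'.Total)) hσ
        have h2 := φ.map_conn _ x h1 v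
        simp only [LinearEquiv.apply_symm_apply] at h2
        rw [h2, LinearEquiv.symm_apply_apply]
      trans := by
        rintro E E' E'' ⟨φ⟩ ⟨ψ⟩
        refine ⟨⟨fun x => (φ.equiv x).trans (ψ.equiv x), ψ.smooth_toFun.comp φ.smooth_toFun,
          φ.smooth_invFun.comp ψ.smooth_invFun, ?_⟩⟩
        intro σ x hσ v
        have h1 : MDifferentiableAt (𝓡 m) ((𝓡 m).prod 𝓘(ℝ, EuclideanSpace ℝ (Fin n)))
            (E'.toTotal (fun y => φ.equiv y (σ y))) x :=
          MDifferentiableAt.comp (I' := (𝓡 m).prod 𝓘(ℝ, EuclideanSpace ℝ (Fin n))) x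
            ((φ.smooth_toFun.mdifferentiable (by simp)) (⟨x, σ x⟩ : E.Total)) hσ
        have h2 := ψ.map_conn _ x h1 v
        rw [φ.map_conn σ x hσ v] at h2
        exact h2 }

/-- The set `ℰ_n` of isomorphism classes of flat bundles of rank `n` over `M`. -/
def IsoClass (m : ℕ) (M : Type u) [TopologicalSpace M]
    [ChartedSpace (EuclideanSpace ℝ (Fin m)) M] [IsManifold (𝓡 m) ∞ M] (n : ℕ) :
    Type (max u (v + 1)) :=
  Quotient (isoSetoid.{u, v} m M n)

/-- The isomorphism class of a flat bundle. -/
def isoClass (E : FlatBundle.{u, v} m M n) : IsoClass.{u, v} m M n :=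
  Quotient.mk (isoSetoid m M n) E

/-- `s = (s_1, …, s_n)` is a smooth frame of `E` over `W` whose members are parallel on `W`. -/
def IsParallelFrameOn (E : FlatBundle.{u, v} m M n) (s : Fin n → Π x : M, E.fiber x)
    (W : Opens M) : Prop :=
  IsLocalFrameOn (𝓡 m) (EuclideanSpace ℝ (Fin n)) ∞ s (W : Set M) ∧
    ∀ i, ∀ x ∈ W, E.conn (s i) x = 0

/-- `t` is the transition cocycle of parallel frames `h_α` of `E` over the members `U_α` of an
open cover: `h_{αi} = ∑ j, (t_{αβ})_{ij} h_{βj}` on `U_α ∩ U_β`. -/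
structure IsTransitionCocycle (E : FlatBundle.{u, v} m M n) (𝒰 : FlatCech.OpenCover M)
    (h : 𝒰.A → Fin n → Π x : M, E.fiber x) (t : FlatCech.Z1 𝒰 n) : Prop where
  frame : ∀ α, E.IsParallelFrameOn (h α) (𝒰.U α)
  transition : ∀ (α β : 𝒰.A) (x : M) (hα : x ∈ 𝒰.U α) (hβ : x ∈ 𝒰.U β) (i : Fin n),
    h α i x = ∑ j, (t.1 α β ⟨x, hα, hβ⟩ : Matrix (Fin n) (Fin n) ℝ) i j • h β j x

/-- All classes in `H¹(M, 𝒢_n)` of transition cocycles of parallel frames, for all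
representatives of `ξ`, all open covers and all choices of parallel frames. -/
def IsoClass.transitionClasses (ξ : IsoClass.{u, v} m M n) : Set (FlatCech.H1 M n) :=
  {c | ∃ (E : FlatBundle.{u, v} m M n) (𝒰 : FlatCech.OpenCover M)
    (h : 𝒰.A → Fin n → Π x : M, E.fiber x) (t : FlatCech.Z1 𝒰 n),
    E.isoClass = ξ ∧ E.IsTransitionCocycle 𝒰 h t ∧ FlatCech.H1.mk 𝒰 t = c}

/-- The class `Θ(ξ)`: the class of the transition cocycle of parallel frames of a representative
of `ξ`. (That it exists and is independent of all choices is not built into the definition.) -/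
def IsoClass.Θ (ξ : IsoClass.{u, v} m M n) : FlatCech.H1 M n :=
  letI : Nonempty (FlatCech.H1 M n) := ⟨1⟩
  Classical.epsilon fun c => c ∈ ξ.transitionClasses

end FlatBundle

end

/-! The heart of the matter is that a flat connection has parallel frames near every point. In a
chart and a trivialization the connection is `d + Γ`, flatness reads `dΓ + Γ ∧ Γ = 0`, and a
parallel section solves `ds = -Γ s`. Solve this linear equation along the rays from the centre. The
value at the end of each ray defines `s`, and vanishing curvature makes `s` satisfy the equation in
every direction, not only the radial one (`hasFDerivAt_radial_transport`). A Gronwall estimate,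
second order in the displacement of the endpoint, replaces differentiability of ODE solutions in a
parameter. `isFlatFormAt_form` translates flatness from the bundle to `Γ`, and
`CovariantDerivative.exists_parallel_frame_of_flat` assembles the frame.

The rest is formal. By the Leibniz rule the coefficients of a parallel section in a parallel frame
have zero differential, so two parallel frames differ by a locally constant matrix
(`IsParallelFrameOn.exists_transition`). This gives transition cocycles. For two choices of data,
the matrices comparing the frames on a common refinement form the 0-cochain that makes the cocycles
cohomologous (`IsTransitionCocycle.mk_eq_mk`). If the class is trivial, with `1 = b_α⁻¹ t_{αβ} b_β`
on a refinement, the frames `b_α⁻¹ h_α` agree on overlaps and glue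
(`IsTransitionCocycle.exists_global_frame`). Conversely, a global parallel frame has cocycle `1` on
the cover by `M` alone. -/

noncomputable section

set_option maxSynthPendingDepth 3

/-! ## Local parallel sections of a flat connection form -/

section FlatForm

open Set Metric Filter Topology

variable {E F : Type*} [NormedAddCommGroup E] [NormedSpace ℝ E]
  [NormedAddCommGroup F] [NormedSpace ℝ F]

/-- A `1`-form with values in endomorphisms is flat at `x` when its curvature `dΓ + Γ ∧ Γ`
vanishes at `x`. -/
def IsFlatFormAt (Γ : E → E →L[ℝ] F →L[ℝ] F) (x : E) : Prop :=
  ∀ (v w : E) (f : F), fderiv ℝ Γ x v w f - fderiv ℝ Γ x w v f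
    + Γ x v (Γ x w f) - Γ x w (Γ x v f) = 0

/-- Read `A = Γ(ty)`, `A' = Γ(t(y + k))`, `D = dΓ(ty)`, and `u` as the transport along the ray to
`y` at time `t`. Then `u - t • A k u` is the first-order guess for the transport to `y + k`, and the
left side is its defect in that ODE. The terms of first order in `k` cancel exactly because the
curvature vanishes. -/
theorem norm_radial_defect_le {A A' : E →L[ℝ] F →L[ℝ] F} {D : E →L[ℝ] E →L[ℝ] F →L[ℝ] F}
    {y k : E} {u : F} {t C C₁ C₂ ρ B : ℝ} (ht : t ∈ Icc (0 : ℝ) 1)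
    (hA : ‖A‖ ≤ C) (hA' : ‖A' - A‖ ≤ C₁ * ‖k‖) (hD : ‖A' - A - t • D k‖ ≤ C₂ * ‖k‖ * ‖k‖)
    (hy : ‖y‖ ≤ ρ) (hyk : ‖y + k‖ ≤ ρ) (hu : ‖u‖ ≤ B)
    (flat : D k y u - D y k u + A k (A y u) - A y (A k u) = 0) :
    ‖-(A y u) - (A k u + t • (D y k u) + t • A k (-(A y u)))
      - -(A' (y + k) (u - t • A k u))‖
      ≤ (C₁ + C₂ * ρ + C * C + C₁ * ρ * C) * B * (‖k‖ * ‖k‖) := by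
  have key : -(A y u) - (A k u + t • (D y k u) + t • A k (-(A y u)))
      - -(A' (y + k) (u - t • A k u))
      = (A' - A) k u + (A' - A - t • D k) y u - t • A k (A k u)
        - t • (A' - A) (y + k) (A k u)
        + t • (D k y u - D y k u + A k (A y u) - A y (A k u)) := by
    simp only [map_add, map_sub, map_smul, map_neg, _root_.add_apply,
      _root_.sub_apply, _root_.smul_apply]
    module
  -- Without the curvature term, each remaining summand contains two factors of size `‖k‖`.
  rw [key, flat, smul_zero, add_zero]
  have hB : 0 ≤ B := (norm_nonneg _).trans hu
  have hC : 0 ≤ C := (norm_nonneg A).trans hA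
  have hρ : 0 ≤ ρ := (norm_nonneg _).trans hy
  have hk := norm_nonneg k
  have hA0 : 0 ≤ C₁ * ‖k‖ := (norm_nonneg (A' - A)).trans hA'
  have hD0 : 0 ≤ C₂ * ‖k‖ * ‖k‖ := (norm_nonneg (A' - A - t • D k)).trans hD
  have e1 : ‖(A' - A) k u‖ ≤ C₁ * ‖k‖ * ‖k‖ * B :=
    (ContinuousLinearMap.le_opNorm₂ _ _ _).trans (by gcongr)
  have e2 : ‖(A' - A - t • D k) y u‖ ≤ C₂ * ‖k‖ * ‖k‖ * ρ * B :=
    (ContinuousLinearMap.le_opNorm₂ _ _ _).trans (by gcongr)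
  have e0 : ‖A k u‖ ≤ C * ‖k‖ * B :=
    (ContinuousLinearMap.le_opNorm₂ _ _ _).trans (by gcongr)
  have smul_le : ∀ z : F, ‖t • z‖ ≤ ‖z‖ := fun z => by
    rw [norm_smul, Real.norm_of_nonneg ht.1]
    exact mul_le_of_le_one_left (norm_nonneg _) ht.2
  have e3 : ‖t • A k (A k u)‖ ≤ C * ‖k‖ * (C * ‖k‖ * B) :=
    (smul_le _).trans ((ContinuousLinearMap.le_opNorm₂ _ _ _).trans (by gcongr))
  have e4 : ‖t • (A' - A) (y + k) (A k u)‖ ≤ C₁ * ‖k‖ * ρ * (C * ‖k‖ * B) :=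
    (smul_le _).trans ((ContinuousLinearMap.le_opNorm₂ _ _ _).trans (by gcongr))
  refine (norm_sub_le_of_le (norm_sub_le_of_le (norm_add_le_of_le e1 e2) e3) e4).trans
    (le_of_eq ?_)
  ring

/-- If `u y` is the radial parallel transport along `t ↦ t • y` of a fixed vector, for a flat
form `Γ`, then `y ↦ u y 1` is parallel. -/
theorem hasFDerivAt_radial_transport {Γ : E → E →L[ℝ] F →L[ℝ] F} {ρ C C₁ C₂ : ℝ}
    (hd : ∀ x ∈ ball (0 : E) ρ, DifferentiableAt ℝ Γ x)
    (hC : ∀ x ∈ ball (0 : E) ρ, ‖Γ x‖ ≤ C) (hC₁ : ∀ x ∈ ball (0 : E) ρ, ‖fderiv ℝ Γ x‖ ≤ C₁)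
    (hC₂0 : 0 ≤ C₂)
    (hC₂ : ∀ x ∈ ball (0 : E) ρ, ∀ y ∈ ball (0 : E) ρ,
      ‖fderiv ℝ Γ x - fderiv ℝ Γ y‖ ≤ C₂ * ‖x - y‖)
    (hflat : ∀ x ∈ ball (0 : E) ρ, IsFlatFormAt Γ x) {f₀ : F} {u : E → ℝ → F}
    (hu0 : ∀ y ∈ ball (0 : E) ρ, u y 0 = f₀)
    (hu : ∀ y ∈ ball (0 : E) ρ, ∀ t ∈ Icc (0 : ℝ) 1,
      HasDerivWithinAt (u y) (-(Γ (t • y) y (u y t))) (Icc 0 1) t) {y : E}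
    (hy : y ∈ ball (0 : E) ρ) :
    HasFDerivAt (fun y => u y 1) (-(Γ y).flip (u y 1)) y := by
  have hρ : 0 < ρ := pos_of_mem_ball hy
  have h0 : (0 : E) ∈ ball (0 : E) ρ := mem_ball_self hρ
  have hC0 : 0 ≤ C := (norm_nonneg _).trans (hC 0 h0)
  have hC₁0 : 0 ≤ C₁ := (norm_nonneg _).trans (hC₁ 0 h0)
  have hconv := convex_ball (0 : E) ρ
  have hmem : ∀ z ∈ ball (0 : E) ρ, ∀ t ∈ Icc (0 : ℝ) 1, t • z ∈ ball (0 : E) ρ :=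
    fun z hz t ht => hconv.smul_mem_of_zero_mem h0 hz ht
  have hcont : ∀ z ∈ ball (0 : E) ρ, ContinuousOn (u z) (Icc 0 1) :=
    fun z hz t ht => (hu z hz t ht).continuousWithinAt
  have hright : ∀ {g : ℝ → F} {g' : F} {t : ℝ}, t ∈ Ico (0 : ℝ) 1 →
      HasDerivWithinAt g g' (Icc 0 1) t → HasDerivWithinAt g g' (Ici t) t :=
    fun ht h => h.mono_of_mem_nhdsWithin
      (mem_of_superset (Icc_mem_nhdsGE ht.2) (Icc_subset_Icc_left ht.1))
  obtain ⟨B, hB⟩ := isCompact_Icc.exists_bound_of_continuousOn (hcont y hy)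
  set Q := (C₁ + C₂ * ρ + C * C + C₁ * ρ * C) * B with hQ
  have hQ0 : 0 ≤ B := (norm_nonneg _).trans (hB 0 (by simp))
  -- The constant must not depend on `k`: the error is then quadratic in `k`, which yields the
  -- derivative.
  have main : ∀ k, y + k ∈ ball (0 : E) ρ →
      ‖u (y + k) 1 - (u y 1 - Γ y k (u y 1))‖
        ≤ gronwallBound 0 (C * ρ + 1) 1 1 * Q * (‖k‖ * ‖k‖) := by
    intro k hk
    have hyn : ‖y‖ ≤ ρ := (mem_ball_zero_iff.1 hy).le
    have hkn : ‖y + k‖ ≤ ρ := (mem_ball_zero_iff.1 hk).le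
    have hline : ∀ t ∈ Icc (0 : ℝ) 1,
        HasDerivWithinAt (fun t : ℝ => Γ (t • y) k) (fderiv ℝ Γ (t • y) y k) (Icc 0 1) t := by
      intro t ht
      have h1 : HasDerivAt (fun t : ℝ => t • y) y t := by
        simpa using (hasDerivAt_id t).smul_const y
      have h2 := ((hd _ (hmem y hy t ht)).hasFDerivAt.comp_hasDerivAt t h1)
      exact (h2.clm_apply (hasDerivAt_const t k)).hasDerivWithinAt.congr_deriv (by simp)
    have hg : ∀ t ∈ Icc (0 : ℝ) 1, HasDerivWithinAt (fun t => u y t - t • Γ (t • y) k (u y t))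
        (-(Γ (t • y) y (u y t)) - (Γ (t • y) k (u y t) + t • (fderiv ℝ Γ (t • y) y k (u y t))
          + t • Γ (t • y) k (-(Γ (t • y) y (u y t))))) (Icc 0 1) t := by
      intro t ht
      have h1 := (hline t ht).clm_apply (hu y hy t ht)
      have h2 := (hasDerivWithinAt_id t (Icc (0 : ℝ) 1)).smul h1
      refine ((hu y hy t ht).sub h2).congr_deriv ?_
      simp only [id, smul_add, one_smul]
      abel
    -- Gronwall compares the exact transport to `y + k` with the guess. Both start at `f₀`, hence `δ
    -- = 0`. The Lipschitz constant is enlarged to `C * ρ + 1` so that it is nonzero and the closed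
    -- form of `gronwallBound`, linear in the defect when `δ = 0`, applies.
    have hbound := dist_le_of_approx_trajectories_ODE_of_mem (a := 0) (b := 1)
      (v := fun t z => -(Γ (t • (y + k)) (y + k) z)) (s := fun _ => univ)
      (K := Real.toNNReal (C * ρ + 1)) (f := u (y + k))
      (f' := fun t => -(Γ (t • (y + k)) (y + k) (u (y + k) t)))
      (g := fun t => u y t - t • Γ (t • y) k (u y t))
      (g' := fun t => -(Γ (t • y) y (u y t)) - (Γ (t • y) k (u y t)
        + t • (fderiv ℝ Γ (t • y) y k (u y t)) + t • Γ (t • y) k (-(Γ (t • y) y (u y t)))))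
      (εf := 0) (εg := Q * (‖k‖ * ‖k‖)) (δ := 0)
      (fun t ht => by
        refine LipschitzOnWith.of_dist_le_mul fun a _ b _ => ?_
        have := hC _ (hmem _ hk t (Ico_subset_Icc_self ht))
        rw [dist_neg_neg, dist_eq_norm, dist_eq_norm, ← map_sub,
          Real.coe_toNNReal _ (by positivity)]
        refine (ContinuousLinearMap.le_opNorm₂ _ _ _).trans ?_
        gcongr
        nlinarith [mul_le_mul this hkn (norm_nonneg _) hC0])
      (hcont _ hk)
      (fun t ht => hright ht (hu _ hk t (Ico_subset_Icc_self ht)))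
      (fun t _ => by simp) (fun _ _ => mem_univ _)
      (fun t ht => (hg t ht).continuousWithinAt)
      (fun t ht => hright ht (hg t (Ico_subset_Icc_self ht)))
      (fun t ht => by
        have ht' := Ico_subset_Icc_self ht
        have hty := hmem y hy t ht'
        have htk := hmem _ hk t ht'
        have hseg : segment ℝ (t • y) (t • (y + k)) ⊆ ball (0 : E) ρ :=
          hconv.segment_subset hty htk
        have hdiff : t • (y + k) - t • y = t • k := by rw [smul_add, add_sub_cancel_left]
        have htk' : ‖t • k‖ ≤ ‖k‖ := by
          rw [norm_smul, Real.norm_of_nonneg ht'.1]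
          exact mul_le_of_le_one_left (norm_nonneg _) ht'.2
        rw [dist_eq_norm]
        refine norm_radial_defect_le ht' (hC _ hty) ?_ ?_ hyn hkn (hB t ht') ?_
        · refine (hconv.norm_image_sub_le_of_norm_fderiv_le hd hC₁ hty htk).trans ?_
          rw [hdiff]
          gcongr
        -- First-order Taylor estimate: on this segment the Lipschitz bound on `fderiv ℝ Γ` keeps it
        -- within `C₂ * ‖k‖` of its value at `t • y`.
        · have := (convex_segment (t • y) (t • (y + k))).norm_image_sub_le_of_norm_fderiv_le'
            (f := Γ) (φ := fderiv ℝ Γ (t • y)) (C := C₂ * ‖k‖)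
            (fun x hx => hd x (hseg hx))
            (fun x hx => by
              refine (hC₂ x (hseg hx) _ hty).trans ?_
              gcongr
              obtain ⟨θ, hθ, rfl⟩ := (segment_eq_image' ℝ _ _).subset hx
              rw [add_sub_cancel_left, hdiff, norm_smul, Real.norm_of_nonneg hθ.1]
              exact (mul_le_of_le_one_left (norm_nonneg _) hθ.2).trans htk')
            (left_mem_segment _ _ _) (right_mem_segment _ _ _)
          rw [hdiff, map_smul] at this
          refine this.trans ?_
          gcongr
        · exact hflat _ hty k y (u y t))
      (fun _ _ => mem_univ _) (by simp [hu0 y hy, hu0 _ hk]) 1 (by simp)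
    rw [dist_eq_norm] at hbound
    simp only [one_smul, zero_add, sub_zero] at hbound
    refine hbound.trans (le_of_eq ?_)
    have hK : C * ρ + 1 ≠ 0 := by positivity
    rw [Real.coe_toNNReal _ (by positivity), gronwallBound_of_K_ne_0 hK,
      gronwallBound_of_K_ne_0 hK]
    ring
  rw [hasFDerivAt_iff_isLittleO_nhds_zero]
  have hO : (fun k => u (y + k) 1 - u y 1 - (-(Γ y).flip (u y 1)) k) =O[𝓝 0]
      fun k => ‖k‖ * ‖k‖ := by
    refine Asymptotics.IsBigO.of_bound (gronwallBound 0 (C * ρ + 1) 1 1 * Q) ?_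
    have : Tendsto (fun k => y + k) (𝓝 0) (𝓝 (y + 0)) := tendsto_id.const_add y
    rw [add_zero] at this
    filter_upwards [this (isOpen_ball.mem_nhds hy)] with k hk
    have := main k hk
    rw [Real.norm_of_nonneg (by positivity)]
    convert this using 2
    simp
    abel
  refine hO.trans_isLittleO ?_
  have h1 : (fun k : E => ‖k‖) =o[𝓝 0] fun _ => (1 : ℝ) :=
    (Asymptotics.isLittleO_one_iff ℝ).2 tendsto_norm_zero
  have h2 := h1.mul_isBigO (Asymptotics.isBigO_refl (fun k : E => ‖k‖) (𝓝 0))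
  simp only [one_mul] at h2
  exact h2.trans_isBigO (Asymptotics.isBigO_norm_left.2 (Asymptotics.isBigO_refl _ _))

/-- Bootstrap: the derivative of `s` is bilinear in `Γ` and `s`, so `s` of class `C^n` forces
`C^(n+1)`. -/
theorem contDiffOn_of_hasFDerivAt_linear {Γ : E → E →L[ℝ] F →L[ℝ] F} {U : Set E} (hU : IsOpen U)
    (hΓ : ContDiffOn ℝ ∞ Γ U) {s : E → F}
    (hs : ∀ x ∈ U, HasFDerivAt s (-(Γ x).flip (s x)) x) : ContDiffOn ℝ ∞ s U := by
  rw [contDiffOn_infty]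
  intro n
  induction n with
  | zero =>
    exact contDiffOn_zero.2 fun x hx => (hs x hx).continuousAt.continuousWithinAt
  | succ n ih =>
    push_cast
    rw [contDiffOn_succ_iff_fderiv_of_isOpen hU]
    refine ⟨fun x hx => (hs x hx).differentiableAt.differentiableWithinAt, by simp, ?_⟩
    have h1 : ContDiffOn ℝ n (fun x => (Γ x).flip) U :=
      (ContinuousLinearMap.flipₗᵢ ℝ E F F).toContinuousLinearEquiv.contDiff.comp_contDiffOn
        (hΓ.of_le (m := n) (by exact_mod_cast le_top))
    exact (h1.clm_apply ih).neg.congr fun x hx => (hs x hx).fderiv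

/-- Near a point, a flat form admits parallel vectors with arbitrary initial value. -/
theorem exists_parallel_of_isFlatFormAt [CompleteSpace F] {Γ : E → E →L[ℝ] F →L[ℝ] F} {r : ℝ}
    (hr : 0 < r) (hΓ : ContDiffOn ℝ ∞ Γ (ball 0 r)) (hflat : ∀ x ∈ ball (0 : E) r, IsFlatFormAt Γ x) :
    ∃ ρ > 0, ρ ≤ r ∧ ∀ f₀ : F, ∃ s : E → F, s 0 = f₀ ∧
      (∀ x ∈ ball (0 : E) ρ, HasFDerivAt s (-(Γ x).flip (s x)) x) ∧
      ContDiffOn ℝ ∞ s (ball 0 ρ) := by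
  have hnhds : ball (0 : E) r ∈ 𝓝 0 := ball_mem_nhds _ hr
  have hΓ0 : ContDiffAt ℝ ∞ Γ 0 := hΓ.contDiffAt hnhds
  have hf0 : ContDiffAt ℝ 1 (fderiv ℝ Γ) 0 :=
    (((contDiffOn_infty_iff_fderiv_of_isOpen isOpen_ball).1 hΓ).2.contDiffAt hnhds).of_le
      (by exact_mod_cast le_top)
  obtain ⟨C₂, S, hS, hLip⟩ := hf0.exists_lipschitzOnWith
  have hC : ∀ᶠ x in 𝓝 (0 : E), ‖Γ x‖ ≤ ‖Γ 0‖ + 1 :=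
    (hΓ0.continuousAt.norm.eventually_lt_const (lt_add_one _)).mono fun _ h => h.le
  have hC₁ : ∀ᶠ x in 𝓝 (0 : E), ‖fderiv ℝ Γ x‖ ≤ ‖fderiv ℝ Γ 0‖ + 1 :=
    (hf0.continuousAt.norm.eventually_lt_const (lt_add_one _)).mono fun _ h => h.le
  obtain ⟨ρ₁, hρ₁, hball⟩ := Metric.mem_nhds_iff.1 (inter_mem (inter_mem hS hnhds) (hC.and hC₁))
  set C := ‖Γ 0‖ + 1
  have hCpos : 0 < C := by positivity
  -- The bound `1 / (2 * C)` gives `‖Γ (t • y) y‖ ≤ 1 / 2` along every ray, so transport exists up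
  -- to time `1` for every initial value, with `ρ` independent of `f₀`.
  set ρ := min (min ρ₁ r) (1 / (2 * C)) with hρdef
  have hρ : 0 < ρ := by positivity
  have hρ1 : ball (0 : E) ρ ⊆ ball 0 ρ₁ :=
    ball_subset_ball ((min_le_left _ _).trans (min_le_left _ _))
  have hρr : ρ ≤ r := (min_le_left _ _).trans (min_le_right _ _)
  have hCρ : C * ρ ≤ 1 / 2 := by
    calc C * ρ ≤ C * (1 / (2 * C)) := by gcongr; exact min_le_right _ _
      _ = 1 / 2 := by field_simp
  refine ⟨ρ, hρ, hρr, fun f₀ => ?_⟩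
  have hd : ∀ x ∈ ball (0 : E) ρ, DifferentiableAt ℝ Γ x := fun x hx =>
    (hΓ.contDiffAt (isOpen_ball.mem_nhds (ball_subset_ball hρr hx))).differentiableAt (by simp)
  have hCb : ∀ x ∈ ball (0 : E) ρ, ‖Γ x‖ ≤ C := fun x hx => (hball (hρ1 hx)).2.1
  have h0 : (0 : E) ∈ ball (0 : E) ρ := mem_ball_self hρ
  have hex : ∀ y : E, ∃ u : ℝ → F, y ∈ ball (0 : E) ρ → u 0 = f₀ ∧ ∀ t ∈ Icc (0 : ℝ) 1,
      HasDerivWithinAt u (-(Γ (t • y) y (u t))) (Icc 0 1) t := by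
    intro y
    by_cases hy : y ∈ ball (0 : E) ρ
    swap
    · exact ⟨0, fun h => (hy h).elim⟩
    have hmem : ∀ t ∈ Icc (0 : ℝ) 1, t • y ∈ ball (0 : E) ρ :=
      fun t ht => (convex_ball (0 : E) ρ).smul_mem_of_zero_mem h0 hy ht
    have hop : ∀ t ∈ Icc (0 : ℝ) 1, ∀ z : F, ‖Γ (t • y) y z‖ ≤ 1 / 2 * ‖z‖ := by
      intro t ht z
      refine (ContinuousLinearMap.le_opNorm₂ _ _ _).trans ?_
      gcongr
      refine le_trans ?_ hCρ
      gcongr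
      · exact hCb _ (hmem t ht)
      · exact (mem_ball_zero_iff.1 hy).le
    -- In the closed ball of radius `‖f₀‖` about `f₀` one has `‖z‖ ≤ 2 * ‖f₀‖`, so the field has
    -- norm at most `‖f₀‖` and a solution cannot leave that ball within unit time.
    have hPL : IsPicardLindelof (fun t z => -(Γ (t • y) y z)) (tmin := 0) (tmax := 1)
        ⟨0, by simp⟩ f₀ ‖f₀‖₊ 0 ‖f₀‖₊ (1 / 2) := by
      refine ⟨fun t ht => ?_, fun z _ => ?_, fun t ht z hz => ?_, by simp⟩
      · refine LipschitzOnWith.of_dist_le_mul fun a _ b _ => ?_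
        rw [dist_neg_neg, dist_eq_norm, dist_eq_norm, ← map_sub]
        simpa using hop t ht (a - b)
      · have h1 : ContinuousOn (fun t : ℝ => Γ (t • y)) (Icc 0 1) := fun t ht =>
          ((hd _ (hmem t ht)).continuousAt.comp (f := fun t : ℝ => t • y)
            (by fun_prop)).continuousWithinAt
        exact ((h1.clm_apply continuousOn_const).clm_apply continuousOn_const).neg
      · rw [norm_neg]
        have h1 : ‖z‖ ≤ 2 * ‖f₀‖ := by
          have := norm_le_norm_add_norm_sub' z f₀
          have h2 : ‖z - f₀‖ ≤ ‖f₀‖ := by simpa [dist_eq_norm] using hz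
          linarith
        have := hop t ht z
        rw [coe_nnnorm]
        linarith
    obtain ⟨α, h1, h2⟩ := hPL.exists_eq_forall_mem_Icc_hasDerivWithinAt₀
    exact ⟨α, fun _ => ⟨h1, h2⟩⟩
  choose u hu using hex
  have hder : ∀ x ∈ ball (0 : E) ρ, HasFDerivAt (fun y => u y 1) (-(Γ x).flip (u x 1)) x :=
    fun x hx => hasFDerivAt_radial_transport hd hCb (fun x hx => (hball (hρ1 hx)).2.2)
      C₂.coe_nonneg
      (fun x hx y hy => by
        simpa [dist_eq_norm] using hLip.dist_le_mul x (hball (hρ1 hx)).1.1 y (hball (hρ1 hy)).1.1)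
      (fun x hx => hflat x (ball_subset_ball hρr hx)) (fun y hy => (hu y hy).1)
      (fun y hy => (hu y hy).2) hx
  refine ⟨fun y => u y 1, ?_, hder, contDiffOn_of_hasFDerivAt_linear isOpen_ball
    (hΓ.mono (ball_subset_ball hρr)) hder⟩
  -- Along the degenerate ray to the centre the equation is `u' = 0`, so the value at time `1` is
  -- still `f₀`.
  have hconst := constant_of_derivWithin_zero (f := u 0) (a := 0) (b := 1)
    (fun t ht => ((hu 0 h0).2 t ht).differentiableWithinAt)
    (fun t ht => by
      have := ((hu 0 h0).2 t (Ico_subset_Icc_self ht)).derivWithin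
        (uniqueDiffOn_Icc zero_lt_one t (Ico_subset_Icc_self ht))
      simpa using this) 1 (by simp)
  exact hconst.trans (hu 0 h0).1

/-- `exists_parallel_of_isFlatFormAt` on a ball with arbitrary centre. -/
theorem exists_parallel_of_isFlatFormAt_ball [CompleteSpace F] {Γ : E → E →L[ℝ] F →L[ℝ] F} {c : E}
    {r : ℝ} (hr : 0 < r) (hΓ : ContDiffOn ℝ ∞ Γ (ball c r))
    (hflat : ∀ x ∈ ball c r, IsFlatFormAt Γ x) :
    ∃ ρ > 0, ρ ≤ r ∧ ∀ f₀ : F, ∃ s : E → F, s c = f₀ ∧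
      (∀ x ∈ ball c ρ, HasFDerivAt s (-(Γ x).flip (s x)) x) ∧ ContDiffOn ℝ ∞ s (ball c ρ) := by
  have hmaps : MapsTo (fun x => c + x) (ball (0 : E) r) (ball c r) := fun x hx => by
    simpa [dist_eq_norm] using hx
  obtain ⟨ρ, hρ, hρr, h⟩ := exists_parallel_of_isFlatFormAt (Γ := fun x => Γ (c + x)) hr
    (hΓ.comp (by fun_prop) hmaps)
    (fun x hx v w f => by
      have := hflat _ (hmaps hx) v w f
      rwa [fderiv_comp_add_left])
  refine ⟨ρ, hρ, hρr, fun f₀ => ?_⟩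
  obtain ⟨s, h0, h1, h2⟩ := h f₀
  have hmem : ∀ {x}, x ∈ ball c ρ → x - c ∈ ball (0 : E) ρ := fun {x} hx => by
    simpa [dist_eq_norm] using hx
  refine ⟨fun x => s (x - c), by simpa using h0, fun x hx => ?_,
    h2.comp (by fun_prop) fun x hx => hmem hx⟩
  have := h1 _ (hmem hx)
  rw [add_sub_cancel] at this
  exact (hasFDerivAt_comp_sub c).2 this

end FlatForm

/-! ## The connection form of a flat bundle in a chart -/

section CovariantDerivative

variable {𝕜 : Type*} [NontriviallyNormedField 𝕜]
  {E : Type*} [NormedAddCommGroup E] [NormedSpace 𝕜 E]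
  {H : Type*} [TopologicalSpace H] {I : ModelWithCorners 𝕜 E H}
  {M : Type*} [TopologicalSpace M] [ChartedSpace H M]
  {F : Type*} [NormedAddCommGroup F] [NormedSpace 𝕜 F]
  {V : M → Type*} [TopologicalSpace (TotalSpace F V)]
  [∀ x, AddCommGroup (V x)] [∀ x, Module 𝕜 (V x)] [∀ x : M, TopologicalSpace (V x)]
  [∀ x, IsTopologicalAddGroup (V x)] [∀ x, ContinuousSMul 𝕜 (V x)]
  [FiberBundle F V] [VectorBundle 𝕜 F V]

omit [∀ x, IsTopologicalAddGroup (V x)] [∀ x, ContinuousSMul 𝕜 (V x)] in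
theorem MDifferentiableAt.sum_smul_section {ι : Type*} (s : Finset ι) {g : ι → M → 𝕜}
    {σ : ι → Π x : M, V x} {x : M} (hg : ∀ i ∈ s, MDiffAt (g i) x)
    (hσ : ∀ i ∈ s, MDiffAt (T% (σ i)) x) :
    MDiffAt (T% (fun y => ∑ i ∈ s, g i y • σ i y)) x :=
  .sum_section fun i hi => (hg i hi).smul_section (hσ i hi)

/-- The Leibniz rule for finite linear combinations of sections. -/
theorem CovariantDerivative.sum_smul (cov : CovariantDerivative I F V) {ι : Type*} (s : Finset ι)
    {g : ι → M → 𝕜} {σ : ι → Π x : M, V x} {x : M} (hg : ∀ i ∈ s, MDiffAt (g i) x)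
    (hσ : ∀ i ∈ s, MDiffAt (T% (σ i)) x) :
    cov (fun y => ∑ i ∈ s, g i y • σ i y) x
      = ∑ i ∈ s, (g i x • cov (σ i) x + (d% (g i) x).smulRight (σ i x)) := by
  classical
  induction s using Finset.induction_on with
  | empty =>
    simp only [Finset.sum_empty]
    exact congrFun cov.zero x
  | insert a s ha ih =>
    have hs : ∀ i ∈ s, i ∈ insert a s := fun i => Finset.mem_insert_of_mem
    have h1 := cov.isCovariantDerivativeOnUniv.add (x := x)
      ((hg a (Finset.mem_insert_self a s)).smul_section (hσ a (Finset.mem_insert_self a s)))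
      (MDifferentiableAt.sum_smul_section s (fun i hi => hg i (hs i hi)) fun i hi => hσ i (hs i hi))
    rw [cov.isCovariantDerivativeOnUniv.leibniz (hσ a (Finset.mem_insert_self a s))
      (hg a (Finset.mem_insert_self a s)),
      ih (fun i hi => hg i (hs i hi)) fun i hi => hσ i (hs i hi)] at h1
    rw [Finset.sum_insert ha, ← h1]
    congr 1
    funext y
    rw [Finset.sum_insert ha]
    rfl

omit [VectorBundle 𝕜 F V] in
/-- A covariant derivative only depends on the germ of a differentiable section. -/
theorem CovariantDerivative.congr_of_eventuallyEq (cov : CovariantDerivative I F V)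
    {σ σ' : Π x : M, V x} {x : M} (hσ : MDiffAt (T% σ) x) (h : ∀ᶠ y in nhds x, σ' y = σ y) :
    cov σ' x = cov σ x := by
  have h' : MDiffAt (T% σ') x := hσ.congr_of_eventuallyEq (h.mono fun y hy => by simp [hy])
  exact cov.isCovariantDerivativeOnUniv.congr_of_eventuallyEq h' hσ Filter.univ_mem h

end CovariantDerivative

/-! ### Coordinate vector fields of a chart -/

section CoordinateField

variable {E : Type*} [NormedAddCommGroup E] [NormedSpace ℝ E]
  {M : Type*} [TopologicalSpace M] [ChartedSpace E M]

/-- The vector field with constant components `v` in the chart at `x₀`. -/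
def coordinateField (x₀ : M) (v : E) : Π x : M, TangentSpace 𝓘(ℝ, E) x :=
  VectorField.mpullback 𝓘(ℝ, E) 𝓘(ℝ, E) (extChartAt 𝓘(ℝ, E) x₀) fun _ => v

theorem contMDiff_constField (v : E) :
    ContMDiff 𝓘(ℝ, E) 𝓘(ℝ, E).tangent ∞ (fun y => (⟨y, v⟩ : TangentBundle 𝓘(ℝ, E) E)) :=
  (contMDiff_vectorSpace_iff_contDiff (V := fun _ : E => v)).2 contDiff_const

variable [IsManifold 𝓘(ℝ, E) ∞ M]

theorem mvfderiv_extChartAt_coordinateField {x₀ x : M} (v : E)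
    (hx : x ∈ (extChartAt 𝓘(ℝ, E) x₀).source) :
    mvfderiv 𝓘(ℝ, E) (extChartAt 𝓘(ℝ, E) x₀) x (coordinateField x₀ v x) = v :=
  (isInvertible_mfderiv_extChartAt (I := 𝓘(ℝ, E)) hx).self_apply_inverse v

theorem coordinateField_mvfderiv_extChartAt {x₀ x : M} (hx : x ∈ (extChartAt 𝓘(ℝ, E) x₀).source)
    (w : TangentSpace 𝓘(ℝ, E) x) :
    coordinateField x₀ (mvfderiv 𝓘(ℝ, E) (extChartAt 𝓘(ℝ, E) x₀) x w) x = w :=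
  (isInvertible_mfderiv_extChartAt (I := 𝓘(ℝ, E)) hx).inverse_apply_self w

variable [CompleteSpace E]

theorem contMDiffOn_coordinateField (x₀ : M) (v : E) :
    ContMDiffOn 𝓘(ℝ, E) 𝓘(ℝ, E).tangent ∞ (T% (coordinateField x₀ v))
      (extChartAt 𝓘(ℝ, E) x₀).source := by
  intro x hx
  have h1 : ContMDiffAt 𝓘(ℝ, E) 𝓘(ℝ, E) ∞ (extChartAt 𝓘(ℝ, E) x₀) x :=
    contMDiffAt_extChartAt' (by rwa [extChartAt_source] at hx)
  have h2 := (contMDiff_constField v).contMDiffAt (x := extChartAt 𝓘(ℝ, E) x₀ x)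
  have h3 := ContMDiffWithinAt.mpullback_vectorField_preimage (t := Set.univ)
    h2.contMDiffWithinAt h1 (isInvertible_mfderiv_extChartAt hx) (by simp)
  exact h3.mono (Set.subset_univ _)

/-- Pullback along the chart commutes with brackets, and constant fields on a vector space commute.
This removes the bracket term from the curvature. -/
theorem mlieBracket_coordinateField {x₀ x : M} (v w : E)
    (hx : x ∈ (extChartAt 𝓘(ℝ, E) x₀).source) :
    VectorField.mlieBracket 𝓘(ℝ, E) (coordinateField x₀ v) (coordinateField x₀ w) x = 0 := by
  have hle : minSmoothness ℝ 2 ≤ ∞ := by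
    rw [minSmoothness_of_isRCLikeNormedField]
    exact WithTop.coe_le_coe.2 (le_top : (2 : ℕ∞) ≤ ⊤)
  have : IsManifold 𝓘(ℝ, E) (minSmoothness ℝ 2) M := .of_le hle
  have h1 : ContMDiffAt 𝓘(ℝ, E) 𝓘(ℝ, E) ∞ (extChartAt 𝓘(ℝ, E) x₀) x :=
    contMDiffAt_extChartAt' (by rwa [extChartAt_source] at hx)
  have h2 := fun v : E => ((contMDiff_constField v).contMDiffAt
    (x := extChartAt 𝓘(ℝ, E) x₀ x)).mdifferentiableAt (by simp)
  have h0 : ∀ y : E, VectorField.mlieBracket 𝓘(ℝ, E) (fun _ => v : Π y : E, TangentSpace 𝓘(ℝ, E) y)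
      (fun _ => w : Π y : E, TangentSpace 𝓘(ℝ, E) y) y = 0 := fun y => by
    refine (congrFun VectorField.mlieBracketWithin_univ y).symm.trans
      ((congrFun VectorField.mlieBracketWithin_eq_lieBracketWithin y).trans ?_)
    simp [VectorField.lieBracketWithin]
    rfl
  rw [coordinateField, coordinateField, ← VectorField.mpullback_mlieBracket (h2 v) (h2 w) h1
    hle, VectorField.mpullback_apply]
  exact (congrArg _ (h0 _)).trans (map_zero _)

end CoordinateField

/-! ### Global fields and sections with constant components near a point -/

section AdaptedFields

open Filter Topology

variable {E : Type*} [NormedAddCommGroup E] [NormedSpace ℝ E]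
  {M : Type*} [TopologicalSpace M] [ChartedSpace E M]
  (F : Type*) [NormedAddCommGroup F] [NormedSpace ℝ F]
  (V : M → Type*) [TopologicalSpace (TotalSpace F V)]
  [∀ x, AddCommGroup (V x)] [∀ x, Module ℝ (V x)] [∀ x : M, TopologicalSpace (V x)]
  [FiberBundle F V] [VectorBundle ℝ F V]

theorem Bundle.Trivialization.contMDiffOn_section_symmL_iff [ContMDiffVectorBundle ∞ F V 𝓘(ℝ, E)]
    (e : Trivialization F (TotalSpace.proj : TotalSpace F V → M)) [MemTrivializationAtlas e]
    {s : Set M} (hs : IsOpen s) (hse : s ⊆ e.baseSet) {g : M → F} :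
    ContMDiffOn 𝓘(ℝ, E) (𝓘(ℝ, E).prod 𝓘(ℝ, F)) ∞ (T% (fun x => e.symmL ℝ x (g x))) s ↔
      ContMDiffOn 𝓘(ℝ, E) 𝓘(ℝ, F) ∞ g s := by
  rw [e.contMDiffOn_section_iff hs hse]
  refine contMDiffOn_congr fun x hx => ?_
  simp [hse hx]

variable [IsManifold 𝓘(ℝ, E) ∞ M]

/-- Globally smooth vector fields and sections which, near `x₀`, are the ones with constant
components in the chart and in the trivialization at `x₀`. -/
structure AdaptedFields (x₀ : M) where
  /-- the neighbourhood on which the fields have constant components -/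
  nhd : Set M
  isOpen_nhd : IsOpen nhd
  mem_nhd : x₀ ∈ nhd
  subset_source : nhd ⊆ (extChartAt 𝓘(ℝ, E) x₀).source
  subset_baseSet : nhd ⊆ (trivializationAt F V x₀).baseSet
  /-- the vector fields -/
  field : E →ₗ[ℝ] Π x : M, TangentSpace 𝓘(ℝ, E) x
  field_smooth : ∀ v, ContMDiff 𝓘(ℝ, E) 𝓘(ℝ, E).tangent ∞ (T% (field v))
  field_eq : ∀ v, ∀ x ∈ nhd, field v x = coordinateField x₀ v x
  /-- the sections -/
  sec : F →ₗ[ℝ] Π x : M, V x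
  sec_smooth : ∀ f, ContMDiff 𝓘(ℝ, E) (𝓘(ℝ, E).prod 𝓘(ℝ, F)) ∞ (T% (sec f))
  sec_eq : ∀ f, ∀ x ∈ nhd, sec f x = (trivializationAt F V x₀).symmL ℝ x f

/-- Flatness is assumed only for globally smooth fields and sections, so the local ones are
multiplied by a bump function equal to `1` near `x₀` and supported in both the chart and the
trivialization domain. -/
theorem nonempty_adaptedFields [FiniteDimensional ℝ E] [T2Space M]
    [ContMDiffVectorBundle ∞ F V 𝓘(ℝ, E)] (x₀ : M) : Nonempty (AdaptedFields (E := E) F V x₀) := by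
  have := FiniteDimensional.complete ℝ E
  set e := trivializationAt F V x₀
  have hW : (extChartAt 𝓘(ℝ, E) x₀).source ∩ e.baseSet ∈ 𝓝 x₀ :=
    inter_mem (extChartAt_source_mem_nhds x₀)
      (e.open_baseSet.mem_nhds (FiberBundle.mem_baseSet_trivializationAt' x₀))
  obtain ⟨χ, -, hχ⟩ := (SmoothBumpFunction.nhds_basis_tsupport (I := 𝓘(ℝ, E)) x₀).mem_iff.1 hW
  obtain ⟨N, hN, hNo, hxN⟩ := eventually_nhds_iff.1 χ.eventuallyEq_one
  have hNW : N ⊆ (extChartAt 𝓘(ℝ, E) x₀).source ∩ e.baseSet := fun x hx =>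
    hχ (subset_tsupport _ (by simp [Function.mem_support, hN x hx]))
  have hχs : ∀ {t : Set M}, ContMDiffOn 𝓘(ℝ, E) 𝓘(ℝ, ℝ) ∞ χ t := χ.contMDiff.contMDiffOn
  exact ⟨{
    nhd := N
    isOpen_nhd := hNo
    mem_nhd := hxN
    subset_source := fun x hx => (hNW hx).1
    subset_baseSet := fun x hx => (hNW hx).2
    field :=
      { toFun := fun v x => χ x • coordinateField x₀ v x
        map_add' := fun v w => by
          funext x
          exact (congrArg (χ x • ·) (map_add _ v w)).trans (smul_add _ _ _)
        map_smul' := fun c v => by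
          funext x
          exact (congrArg (χ x • ·) (map_smul _ c v)).trans (smul_comm _ _ _) }
    field_smooth := fun v => ContMDiffOn.smul_section_of_tsupport hχs (isOpen_extChartAt_source x₀)
      (hχ.trans Set.inter_subset_left) (contMDiffOn_coordinateField x₀ v)
    field_eq := fun v x hx => by
      change χ x • coordinateField x₀ v x = _
      rw [hN x hx]
      exact one_smul _ _
    sec :=
      { toFun := fun f x => χ x • e.symmL ℝ x f
        map_add' := fun v w => by
          funext x
          exact (congrArg (χ x • ·) (map_add _ v w)).trans (smul_add _ _ _)
        map_smul' := fun c v => by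
          funext x
          exact (congrArg (χ x • ·) (map_smul _ c v)).trans (smul_comm _ _ _) }
    sec_smooth := fun f => ContMDiffOn.smul_section_of_tsupport hχs e.open_baseSet
      (hχ.trans Set.inter_subset_right)
      ((e.contMDiffOn_section_symmL_iff F V e.open_baseSet subset_rfl).2 contMDiffOn_const)
    sec_eq := fun f x hx => by
      change χ x • e.symmL ℝ x f = _
      rw [hN x hx]
      exact one_smul _ _ }⟩

end AdaptedFields

/-! ### Covariant derivative and curvature in coordinates -/

section ConnectionForm

open Filter Topology

variable {E : Type*} [NormedAddCommGroup E] [NormedSpace ℝ E]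
  {M : Type*} [TopologicalSpace M] [ChartedSpace E M]
  {F : Type*} [NormedAddCommGroup F] [NormedSpace ℝ F]

theorem mvfderiv_comp_of_differentiableAt {G : Type*} [NormedAddCommGroup G] [NormedSpace ℝ G]
    {g : M → F} {L : F → G} {x : M} (hL : DifferentiableAt ℝ L (g x))
    (hg : MDifferentiableAt 𝓘(ℝ, E) 𝓘(ℝ, F) g x) (w : TangentSpace 𝓘(ℝ, E) x) :
    mvfderiv 𝓘(ℝ, E) (fun y => L (g y)) x w
      = fderiv ℝ L (g x) (mvfderiv 𝓘(ℝ, E) g x w) := by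
  have h := (hL.hasFDerivAt.hasMFDerivAt.comp x hg.hasMFDerivAt).mfderiv
  exact congrArg (fun A : TangentSpace 𝓘(ℝ, E) x →L[ℝ] G => A w) h

theorem mvfderiv_congr_of_eventuallyEq {g g' : M → F} {x : M} (h : g' =ᶠ[𝓝 x] g) :
    mvfderiv 𝓘(ℝ, E) g' x = mvfderiv 𝓘(ℝ, E) g x := by
  have h1 := h.mfderiv_eq (I := 𝓘(ℝ, E)) (I' := 𝓘(ℝ, F))
  ext w
  exact congrArg (fun A : E →L[ℝ] F => A w) h1

variable {V : M → Type*} [TopologicalSpace (TotalSpace F V)]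
  [∀ x, AddCommGroup (V x)] [∀ x, Module ℝ (V x)] [∀ x : M, TopologicalSpace (V x)]
  [FiberBundle F V] [VectorBundle ℝ F V] [IsManifold 𝓘(ℝ, E) ∞ M]

namespace AdaptedFields

variable {x₀ : M} (A : AdaptedFields (E := E) F V x₀)

/-- The value of a section in the trivialization at `x₀`. -/
def coord (_ : AdaptedFields (E := E) F V x₀) (x : M) : V x →ₗ[ℝ] F :=
  (trivializationAt F V x₀).linearMapAt ℝ x

theorem coord_apply {x : M} (hx : x ∈ A.nhd) (p : V x) :
    A.coord x p = (trivializationAt F V x₀ ⟨x, p⟩).2 := by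
  simp [coord, Trivialization.coe_linearMapAt_of_mem _ (A.subset_baseSet hx)]

theorem coord_sec {x : M} (hx : x ∈ A.nhd) (f : F) : A.coord x (A.sec f x) = f := by
  rw [A.sec_eq f x hx]
  exact Trivialization.linearMapAt_symmₗ _ (A.subset_baseSet hx) f

theorem sec_coord {x : M} (hx : x ∈ A.nhd) (p : V x) : A.sec (A.coord x p) x = p := by
  rw [A.sec_eq _ x hx]
  exact Trivialization.symmₗ_linearMapAt _ (A.subset_baseSet hx) p

theorem coord_injective {x : M} (hx : x ∈ A.nhd) : Function.Injective (A.coord x) := fun p q h => by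
  rw [← A.sec_coord hx p, h, A.sec_coord hx q]

theorem nhd_mem {x : M} (hx : x ∈ A.nhd) : A.nhd ∈ 𝓝 x := A.isOpen_nhd.mem_nhds hx

theorem mdifferentiableAt_extChartAt {x : M} (hx : x ∈ A.nhd) :
    MDifferentiableAt 𝓘(ℝ, E) 𝓘(ℝ, E) (extChartAt 𝓘(ℝ, E) x₀) x := by
  have := A.subset_source hx
  rw [extChartAt_source] at this
  exact _root_.mdifferentiableAt_extChartAt this

theorem mvfderiv_comp_extChartAt {G : E → F} {x : M} (hx : x ∈ A.nhd)
    (hG : DifferentiableAt ℝ G (extChartAt 𝓘(ℝ, E) x₀ x)) (v : E) :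
    mvfderiv 𝓘(ℝ, E) (fun y => G (extChartAt 𝓘(ℝ, E) x₀ y)) x (A.field v x)
      = fderiv ℝ G (extChartAt 𝓘(ℝ, E) x₀ x) v := by
  rw [mvfderiv_comp_of_differentiableAt hG (A.mdifferentiableAt_extChartAt hx), A.field_eq v x hx,
    mvfderiv_extChartAt_coordinateField v (A.subset_source hx)]

theorem mlieBracket_field [CompleteSpace E] {x : M} (hx : x ∈ A.nhd) (v w : E) :
    VectorField.mlieBracket 𝓘(ℝ, E) (A.field v) (A.field w) x = 0 := by
  have h : ∀ v, A.field v =ᶠ[𝓝 x] coordinateField x₀ v := fun v => by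
    filter_upwards [A.nhd_mem hx] with y hy using A.field_eq v y hy
  rw [(h v).mlieBracket_vectorField_eq (h w)]
  exact mlieBracket_coordinateField v w (A.subset_source hx)

/-- Lets the vanishing of a covariant derivative be tested on adapted fields only. -/
theorem exists_field_eq {x : M} (hx : x ∈ A.nhd) (w : TangentSpace 𝓘(ℝ, E) x) :
    ∃ v, A.field v x = w :=
  ⟨_, (A.field_eq _ x hx).trans (coordinateField_mvfderiv_extChartAt (A.subset_source hx) w)⟩

theorem contMDiffOn_coord [ContMDiffVectorBundle ∞ F V 𝓘(ℝ, E)] {τ : Π x : M, V x} {s : Set M}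
    (hs : IsOpen s) (hsA : s ⊆ A.nhd)
    (hτ : ContMDiffOn 𝓘(ℝ, E) (𝓘(ℝ, E).prod 𝓘(ℝ, F)) ∞ (T% τ) s) :
    ContMDiffOn 𝓘(ℝ, E) 𝓘(ℝ, F) ∞ (fun x => A.coord x (τ x)) s := by
  rw [(trivializationAt F V x₀).contMDiffOn_section_iff hs (hsA.trans A.subset_baseSet)] at hτ
  exact hτ.congr fun x hx => A.coord_apply (hsA hx) _

theorem mdifferentiableAt_coord [ContMDiffVectorBundle 1 F V 𝓘(ℝ, E)] {τ : Π x : M, V x} {x : M}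
    (hx : x ∈ A.nhd) (hτ : MDifferentiableAt 𝓘(ℝ, E) (𝓘(ℝ, E).prod 𝓘(ℝ, F)) (T% τ) x) :
    MDifferentiableAt 𝓘(ℝ, E) 𝓘(ℝ, F) (fun x => A.coord x (τ x)) x := by
  rw [(trivializationAt F V x₀).mdifferentiableAt_section_iff _ _ (A.subset_baseSet hx)] at hτ
  refine hτ.congr_of_eventuallyEq ?_
  filter_upwards [A.nhd_mem hx] with y hy using A.coord_apply hy _

/-- The image of the adapted neighbourhood in the chart. -/
def chartNhd : Set E := (extChartAt 𝓘(ℝ, E) x₀).target ∩ (extChartAt 𝓘(ℝ, E) x₀).symm ⁻¹' A.nhd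

theorem isOpen_chartNhd : IsOpen A.chartNhd :=
  (continuousOn_extChartAt_symm x₀).isOpen_inter_preimage (isOpen_extChartAt_target x₀) A.isOpen_nhd

theorem extChartAt_mem_chartNhd {x : M} (hx : x ∈ A.nhd) :
    extChartAt 𝓘(ℝ, E) x₀ x ∈ A.chartNhd :=
  ⟨(extChartAt 𝓘(ℝ, E) x₀).map_source (A.subset_source hx), by
    rwa [Set.mem_preimage, (extChartAt 𝓘(ℝ, E) x₀).left_inv (A.subset_source hx)]⟩

variable [∀ x, IsTopologicalAddGroup (V x)] [∀ x, ContinuousSMul ℝ (V x)]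
  (cov : CovariantDerivative 𝓘(ℝ, E) F V)

omit [∀ x, IsTopologicalAddGroup (V x)] [∀ x, ContinuousSMul ℝ (V x)] in
theorem mdifferentiableAt_sec (f : F) (x : M) :
    MDifferentiableAt 𝓘(ℝ, E) (𝓘(ℝ, E).prod 𝓘(ℝ, F)) (T% (A.sec f)) x :=
  (A.sec_smooth f).mdifferentiable (by simp) x

/-- The connection form at `x` in the trivialization at `x₀`. -/
def christoffel (x : M) : E →ₗ[ℝ] F →ₗ[ℝ] F :=
  LinearMap.mk₂ ℝ (fun v f => A.coord x (cov (A.sec f) x (A.field v x)))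
    (fun v w f => by rw [map_add A.field, Pi.add_apply, map_add, map_add])
    (fun c v f => by rw [map_smul A.field, Pi.smul_apply, map_smul, map_smul])
    (fun v f g => by
      rw [map_add A.sec, cov.isCovariantDerivativeOnUniv.add (A.mdifferentiableAt_sec f x)
        (A.mdifferentiableAt_sec g x), _root_.add_apply, map_add])
    (fun c v f => by
      rw [map_smul A.sec, cov.isCovariantDerivativeOnUniv.smul_const c (A.mdifferentiableAt_sec f x),
        _root_.smul_apply, map_smul])

theorem christoffel_apply (x : M) (v : E) (f : F) :
    A.christoffel cov x v f = A.coord x (cov (A.sec f) x (A.field v x)) := rfl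

/-- The covariant derivative of a section in the trivialization at `x₀`. -/
theorem coord_covariantDerivative [FiniteDimensional ℝ F] [ContMDiffVectorBundle 1 F V 𝓘(ℝ, E)]
    {τ : Π x : M, V x} {x : M} (hx : x ∈ A.nhd)
    (hτ : MDifferentiableAt 𝓘(ℝ, E) (𝓘(ℝ, E).prod 𝓘(ℝ, F)) (T% τ) x) (v : E) :
    A.coord x (cov τ x (A.field v x))
      = mvfderiv 𝓘(ℝ, E) (fun y => A.coord y (τ y)) x (A.field v x)
        + A.christoffel cov x v (A.coord x (τ x)) := by
  set g : M → F := fun y => A.coord y (τ y) with hg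
  have hgd : MDifferentiableAt 𝓘(ℝ, E) 𝓘(ℝ, F) g x := A.mdifferentiableAt_coord hx hτ
  set b := Module.finBasis ℝ F
  set L : Fin (Module.finrank ℝ F) → F →L[ℝ] ℝ := fun i => (b.coord i).toContinuousLinearMap
  have hL : ∀ f, ∑ i, L i f • b i = f := fun f => b.sum_repr f
  have hLg : ∀ i, MDifferentiableAt 𝓘(ℝ, E) 𝓘(ℝ, ℝ) (fun y => L i (g y)) x := fun i =>
    ((L i).differentiableAt.mdifferentiableAt (x := g x)).comp x hgd
  have hdLg : ∀ i w, mvfderiv 𝓘(ℝ, E) (fun y => L i (g y)) x w = L i (mvfderiv 𝓘(ℝ, E) g x w) :=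
    fun i w => by
      rw [mvfderiv_comp_of_differentiableAt (L i).differentiableAt hgd, ContinuousLinearMap.fderiv]
  -- Near `x`, `τ` is a combination of adapted sections. The Leibniz rule then splits its derivative
  -- into the differential of the coordinates and the connection form.
  have heq : ∀ᶠ y in 𝓝 x, τ y = ∑ i, L i (g y) • A.sec (b i) y := by
    filter_upwards [A.nhd_mem hx] with y hy
    conv_lhs => rw [← A.sec_coord hy (τ y), ← hL (A.coord y (τ y))]
    simp [hg]
  have hσ : ∀ i, MDifferentiableAt 𝓘(ℝ, E) (𝓘(ℝ, E).prod 𝓘(ℝ, F)) (T% (A.sec (b i))) x :=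
    fun i => A.mdifferentiableAt_sec _ x
  rw [cov.congr_of_eventuallyEq
    (MDifferentiableAt.sum_smul_section Finset.univ (fun i _ => hLg i) fun i _ => hσ i) heq,
    cov.sum_smul Finset.univ (fun i _ => hLg i) fun i _ => hσ i]
  simp only [sum_apply, _root_.add_apply, _root_.smul_apply, ContinuousLinearMap.smulRight_apply,
    map_sum, map_add, map_smul, hdLg, A.coord_sec hx, Finset.sum_add_distrib, hL]
  rw [add_comm]
  congr 1
  conv_rhs => rw [← hL (A.coord x (τ x))]
  simp [christoffel_apply, hg]

/-- Permits a second covariant differentiation, as the curvature requires. -/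
theorem contMDiff_covariantDerivative [CovariantDerivative.ContMDiffCovariantDerivative cov ∞]
    (f : F) (v : E) :
    ContMDiff 𝓘(ℝ, E) (𝓘(ℝ, E).prod 𝓘(ℝ, F)) ∞ (T% (fun x => cov (A.sec f) x (A.field v x))) := by
  have h := (CovariantDerivative.ContMDiffCovariantDerivative.contMDiff (cov := cov)
    (k := ∞)).contMDiff (σ := A.sec f) (by simpa using (A.sec_smooth f).contMDiffOn)
  exact (contMDiffOn_univ.1 h).clm_bundle_apply (A.field_smooth v)

variable [FiniteDimensional ℝ E] [FiniteDimensional ℝ F]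

/-- The connection form in the chart and the trivialization at `x₀`. -/
def form (z : E) : E →L[ℝ] F →L[ℝ] F :=
  (A.christoffel cov ((extChartAt 𝓘(ℝ, E) x₀).symm z)).toContinuousBilinearMap

theorem form_apply {x : M} (hx : x ∈ A.nhd) (v : E) (f : F) :
    A.form cov (extChartAt 𝓘(ℝ, E) x₀ x) v f = A.coord x (cov (A.sec f) x (A.field v x)) := by
  rw [form, LinearMap.toContinuousBilinearMap_apply,
    (extChartAt 𝓘(ℝ, E) x₀).left_inv (A.subset_source hx), christoffel_apply]

variable [CovariantDerivative.ContMDiffCovariantDerivative cov ∞]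

variable [ContMDiffVectorBundle ∞ F V 𝓘(ℝ, E)]

theorem contDiffOn_form : ContDiffOn ℝ ∞ (A.form cov) A.chartNhd := by
  rw [contDiffOn_clm_apply]
  intro v
  rw [contDiffOn_clm_apply]
  intro f
  rw [← contMDiffOn_iff_contDiffOn]
  exact (A.contMDiffOn_coord A.isOpen_nhd subset_rfl
    (A.contMDiff_covariantDerivative cov f v).contMDiffOn).comp
    ((contMDiffOn_extChartAt_symm x₀).mono Set.inter_subset_left) fun z hz => hz.2

theorem differentiableAt_form {x : M} (hx : x ∈ A.nhd) :
    DifferentiableAt ℝ (A.form cov) (extChartAt 𝓘(ℝ, E) x₀ x) :=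
  ((A.contDiffOn_form cov).contDiffAt
    (A.isOpen_chartNhd.mem_nhds (A.extChartAt_mem_chartNhd hx))).differentiableAt (by simp)

theorem mvfderiv_coord_covariantDerivative {x : M} (hx : x ∈ A.nhd) (v w : E) (f : F) :
    mvfderiv 𝓘(ℝ, E) (fun y => A.coord y (cov (A.sec f) y (A.field v y))) x (A.field w x)
      = fderiv ℝ (A.form cov) (extChartAt 𝓘(ℝ, E) x₀ x) w v f := by
  have h : (fun y => A.coord y (cov (A.sec f) y (A.field v y))) =ᶠ[𝓝 x]
      fun y => A.form cov (extChartAt 𝓘(ℝ, E) x₀ y) v f := by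
    filter_upwards [A.nhd_mem hx] with y hy using (A.form_apply cov hy v f).symm
  have hd := A.differentiableAt_form cov hx
  have hd' := ((hd.hasFDerivAt.clm_apply (hasFDerivAt_const v _)).clm_apply
    (hasFDerivAt_const f _))
  rw [mvfderiv_congr_of_eventuallyEq h,
    A.mvfderiv_comp_extChartAt (G := fun z => A.form cov z v f) hx hd'.differentiableAt, hd'.fderiv]
  simp

variable [ContMDiffVectorBundle 1 F V 𝓘(ℝ, E)]

/-- Evaluate the curvature on adapted fields, whose bracket vanishes near `x₀`. Each iterated
covariant derivative unfolds to one term of `dΓ` plus one term of `Γ ∧ Γ`. -/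
theorem isFlatFormAt_form
    (hflat : ∀ (X Y : Π x : M, TangentSpace 𝓘(ℝ, E) x) (σ : Π x : M, V x),
      ContMDiff 𝓘(ℝ, E) 𝓘(ℝ, E).tangent ∞ (T% X) → ContMDiff 𝓘(ℝ, E) 𝓘(ℝ, E).tangent ∞ (T% Y) →
      ContMDiff 𝓘(ℝ, E) (𝓘(ℝ, E).prod 𝓘(ℝ, F)) ∞ (T% σ) → ∀ x : M,
      cov (fun y => cov σ y (Y y)) x (X x) - cov (fun y => cov σ y (X y)) x (Y x)
        - cov σ x (VectorField.mlieBracket 𝓘(ℝ, E) X Y x) = 0) {z : E} (hz : z ∈ A.chartNhd) :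
    IsFlatFormAt (A.form cov) z := by
  have := FiniteDimensional.complete ℝ E
  set x := (extChartAt 𝓘(ℝ, E) x₀).symm z with hxdef
  have hx : x ∈ A.nhd := hz.2
  have hzx : z = extChartAt 𝓘(ℝ, E) x₀ x := ((extChartAt 𝓘(ℝ, E) x₀).right_inv hz.1).symm
  intro v w f
  have h := hflat (A.field v) (A.field w) (A.sec f) (A.field_smooth v) (A.field_smooth w)
    (A.sec_smooth f) x
  rw [A.mlieBracket_field hx, map_zero, sub_zero] at h
  have h2 := congrArg (A.coord x) h
  have hd := fun w => (A.contMDiff_covariantDerivative cov f w).mdifferentiable (by simp) x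
  rw [map_sub, map_zero, A.coord_covariantDerivative cov hx (hd w),
    A.coord_covariantDerivative cov hx (hd v), A.mvfderiv_coord_covariantDerivative cov hx,
    A.mvfderiv_coord_covariantDerivative cov hx, christoffel_apply, christoffel_apply,
    ← A.form_apply cov hx, ← A.form_apply cov hx, ← A.form_apply cov hx, ← A.form_apply cov hx,
    ← hzx] at h2
  rw [← h2]
  abel

end AdaptedFields

end ConnectionForm

/-! ### Local parallel frames -/

section ParallelFrame

open Filter Topology

variable {E : Type*} [NormedAddCommGroup E] [NormedSpace ℝ E] [FiniteDimensional ℝ E]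
  {M : Type*} [TopologicalSpace M] [ChartedSpace E M] [IsManifold 𝓘(ℝ, E) ∞ M] [T2Space M]
  {F : Type*} [NormedAddCommGroup F] [NormedSpace ℝ F] [FiniteDimensional ℝ F]
  {V : M → Type*} [TopologicalSpace (TotalSpace F V)]
  [∀ x, AddCommGroup (V x)] [∀ x, Module ℝ (V x)] [∀ x : M, TopologicalSpace (V x)]
  [∀ x, IsTopologicalAddGroup (V x)] [∀ x, ContinuousSMul ℝ (V x)]
  [FiberBundle F V] [VectorBundle ℝ F V] [ContMDiffVectorBundle ∞ F V 𝓘(ℝ, E)]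

/-- A flat connection has a parallel frame near every point. -/
theorem CovariantDerivative.exists_parallel_frame_of_flat (cov : CovariantDerivative 𝓘(ℝ, E) F V)
    [CovariantDerivative.ContMDiffCovariantDerivative cov ∞]
    (hflat : ∀ (X Y : Π x : M, TangentSpace 𝓘(ℝ, E) x) (σ : Π x : M, V x),
      ContMDiff 𝓘(ℝ, E) 𝓘(ℝ, E).tangent ∞ (T% X) → ContMDiff 𝓘(ℝ, E) 𝓘(ℝ, E).tangent ∞ (T% Y) →
      ContMDiff 𝓘(ℝ, E) (𝓘(ℝ, E).prod 𝓘(ℝ, F)) ∞ (T% σ) → ∀ x : M,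
      cov (fun y => cov σ y (Y y)) x (X x) - cov (fun y => cov σ y (X y)) x (Y x)
        - cov σ x (VectorField.mlieBracket 𝓘(ℝ, E) X Y x) = 0)
    {ι : Type*} [Fintype ι] (b : Module.Basis ι ℝ F) (x₀ : M) :
    ∃ U : Opens M, x₀ ∈ U ∧ ∃ s : ι → Π x : M, V x,
      IsLocalFrameOn 𝓘(ℝ, E) F ∞ s (U : Set M) ∧ ∀ i, ∀ x ∈ U, cov (s i) x = 0 := by
  classical
  have : ContMDiffVectorBundle 1 F V 𝓘(ℝ, E) := ContMDiffVectorBundle.of_le (n := ∞) (by simp)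
  have := FiniteDimensional.complete ℝ E
  have := FiniteDimensional.complete ℝ F
  obtain ⟨A⟩ := nonempty_adaptedFields (E := E) F V x₀
  set φ := extChartAt 𝓘(ℝ, E) x₀
  set e := trivializationAt F V x₀
  obtain ⟨r, hr, hball⟩ := Metric.isOpen_iff.1 A.isOpen_chartNhd _
    (A.extChartAt_mem_chartNhd A.mem_nhd)
  obtain ⟨ρ, hρ, hρr, H⟩ := exists_parallel_of_isFlatFormAt_ball hr
    ((A.contDiffOn_form cov).mono hball) fun z hz => A.isFlatFormAt_form cov hflat (hball hz)
  choose s hsc hds hs using H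
  have hφ : ContinuousAt φ x₀ := continuousAt_extChartAt x₀
  -- The solutions start at the basis `b`, so their determinant is `1` at `x₀`. By continuity it
  -- stays nonzero nearby, where they remain a basis.
  have hcont : ContinuousAt (fun x => b.det fun i => s (b i) (φ x)) x₀ := by
    have h : ∀ i, ContinuousAt (fun x => s (b i) (φ x)) x₀ := fun i =>
      ContinuousAt.comp (g := s (b i)) (hds (b i) _ (Metric.mem_ball_self hρ)).continuousAt hφ
    simp only [Module.Basis.det_apply]
    refine ContinuousAt.comp (g := Matrix.det)
      (Continuous.matrix_det continuous_id).continuousAt ?_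
    refine continuousAt_pi.2 fun i => continuousAt_pi.2 fun j => ?_
    exact ContinuousAt.comp (g := fun f => b.repr f i)
      (LinearMap.continuous_of_finiteDimensional (b.coord i)).continuousAt (h j)
  have hev : ∀ᶠ x in 𝓝 x₀, x ∈ A.nhd ∧ φ x ∈ Metric.ball (φ x₀) ρ ∧
      (b.det fun i => s (b i) (φ x)) ≠ 0 := by
    refine Filter.Eventually.and (A.nhd_mem A.mem_nhd) ((hφ.eventually (Metric.ball_mem_nhds _ hρ)).and
      (hcont.eventually_ne ?_))
    have h : (fun i => s (b i) (φ x₀)) = b := funext fun i => hsc (b i)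
    rw [h, b.det_self]
    exact one_ne_zero
  obtain ⟨U, hU, hUo, hxU⟩ := eventually_nhds_iff.1 hev
  have hUA : U ⊆ A.nhd := fun x hx => (hU x hx).1
  have hτ : ∀ i, ContMDiffOn 𝓘(ℝ, E) (𝓘(ℝ, E).prod 𝓘(ℝ, F)) ∞
      (T% (fun x => e.symmL ℝ x (s (b i) (φ x)))) U := fun i => by
    rw [e.contMDiffOn_section_symmL_iff F V hUo (hUA.trans A.subset_baseSet)]
    exact (hs (b i)).contMDiffOn.comp ((contMDiffOn_extChartAt (n := ∞)).mono fun x hx => by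
      simpa [φ] using A.subset_source (hUA hx)) fun x hx => (hU x hx).2.1
  refine ⟨⟨U, hUo⟩, hxU, fun i x => e.symmL ℝ x (s (b i) (φ x)), ?_, fun i x hx => ?_⟩
  · have hB : ∀ {x}, x ∈ U → ∃ B : Module.Basis ι ℝ (V x),
        ∀ i, B i = e.symmL ℝ x (s (b i) (φ x)) := fun {x} hx => by
      obtain ⟨h1, h2⟩ := (Module.Basis.is_basis_iff_det b).2 (isUnit_iff_ne_zero.2 (hU x hx).2.2)
      refine ⟨(Module.Basis.mk h1 h2.ge).map
        (e.linearEquivAt ℝ x (A.subset_baseSet (hUA hx))).symm, fun i => ?_⟩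
      rw [Module.Basis.map_apply, Module.Basis.mk_apply,
        e.symmL_apply (A.subset_baseSet (hUA hx))]
      rfl
    refine ⟨fun {x} hx => ?_, fun {x} hx => ?_, hτ⟩
    · obtain ⟨B, hB⟩ := hB hx
      simpa only [← hB] using B.linearIndependent
    · obtain ⟨B, hB⟩ := hB hx
      have := B.span_eq.ge
      rwa [show (B : ι → V x) = _ from funext hB] at this
  · have hxA := hUA hx
    have hcoord : ∀ y ∈ U, A.coord y (e.symmL ℝ y (s (b i) (φ y))) = s (b i) (φ y) := fun y hy => by
      rw [← A.sec_eq _ y (hUA hy), A.coord_sec (hUA hy)]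
    ext w
    obtain ⟨v, rfl⟩ := A.exists_field_eq hxA w
    refine A.coord_injective hxA ?_
    have hev : (fun y => A.coord y (e.symmL ℝ y (s (b i) (φ y)))) =ᶠ[𝓝 x] fun y => s (b i) (φ y) :=
      by filter_upwards [hUo.mem_nhds hx] with y hy using hcoord y hy
    -- The equation `ds = -Γ s` cancels the connection form in the coordinate formula for `cov`.
    have hd := hds (b i) _ (hU x hx).2.1
    rw [A.coord_covariantDerivative cov hxA
      (((hτ i).contMDiffAt (hUo.mem_nhds hx)).mdifferentiableAt (by simp)),
      mvfderiv_congr_of_eventuallyEq hev, A.mvfderiv_comp_extChartAt hxA hd.differentiableAt,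
      hd.fderiv, hcoord x hx, AdaptedFields.christoffel_apply, ← A.form_apply cov hxA]
    simp [φ]

end ParallelFrame

/-! ### Coefficients of sections in frames -/

section FrameCoefficients

open Filter Topology

variable {E : Type*} [NormedAddCommGroup E] [NormedSpace ℝ E]
  {M : Type*} [TopologicalSpace M] [ChartedSpace E M]
  {F : Type*} [NormedAddCommGroup F] [NormedSpace ℝ F] [FiniteDimensional ℝ F]
  {V : M → Type*} [TopologicalSpace (TotalSpace F V)]
  [∀ x, AddCommGroup (V x)] [∀ x, Module ℝ (V x)] [∀ x : M, TopologicalSpace (V x)]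
  [FiberBundle F V] [VectorBundle ℝ F V]

/-- The coefficients of a differentiable section in a local frame are differentiable. -/
theorem IsLocalFrameOn.mdifferentiableAt_coeff [IsManifold 𝓘(ℝ, E) 1 M]
    [ContMDiffVectorBundle 1 F V 𝓘(ℝ, E)]
    {ι : Type*} [Fintype ι] {s : ι → Π x : M, V x} {U : Set M}
    (hs : IsLocalFrameOn 𝓘(ℝ, E) F ∞ s U) (hU : IsOpen U) {x : M} (hx : x ∈ U)
    {τ : Π x : M, V x} (hτ : MDifferentiableAt 𝓘(ℝ, E) (𝓘(ℝ, E).prod 𝓘(ℝ, F)) (T% τ) x) (i : ι) :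
    MDifferentiableAt 𝓘(ℝ, E) 𝓘(ℝ, ℝ) (fun y => hs.coeff i y (τ y)) x := by
  have := FiniteDimensional.complete ℝ F
  set e := trivializationAt F V x
  have hxe : x ∈ e.baseSet := FiberBundle.mem_baseSet_trivializationAt' x
  -- `T w` sends coefficients `c` to `∑ i, c i • w i`. For a frame read in the trivialization it is
  -- invertible, and its inverse recovers the coefficients. Differentiability then follows from that
  -- of operator inversion.
  set T : (ι → F) →ₗ[ℝ] ((ι → ℝ) →L[ℝ] F) :=
    { toFun := fun w => ∑ i, (ContinuousLinearMap.proj i : (ι → ℝ) →L[ℝ] ℝ).smulRight (w i)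
      map_add' := fun w w' => by ext; simp [Finset.sum_add_distrib]
      map_smul' := fun c w => by ext; simp [Finset.smul_sum, smul_comm c] } with hT
  have hTd : ∀ w, DifferentiableAt ℝ T w := fun w =>
    (LinearMap.toContinuousLinearMap T).differentiableAt
  set w : M → ι → F := fun y i => (e ⟨y, s i y⟩).2
  have hw : MDifferentiableAt 𝓘(ℝ, E) 𝓘(ℝ, ι → F) w x :=
    (contMDiffAt_pi_space.2 fun i => (e.contMDiffAt_section_iff hxe).1
      ((hs.contMDiffAt hU hx i).of_le (by simp : (1 : WithTop ℕ∞) ≤ ∞))).mdifferentiableAt one_ne_zero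
  have hτ' := (e.mdifferentiableAt_section_iff _ _ hxe).1 hτ
  have hL : ∀ y ∈ U ∩ e.baseSet, ∃ Λ : (ι → ℝ) ≃L[ℝ] F, (Λ : (ι → ℝ) →L[ℝ] F) = T (w y) ∧
      ∀ i, hs.coeff i y (τ y) = Λ.symm (e ⟨y, τ y⟩).2 i := by
    rintro y ⟨hy, hye⟩
    refine ⟨((hs.toBasisAt hy).equivFun.symm.trans
      (e.linearEquivAt ℝ y hye)).toContinuousLinearEquiv, ?_, fun i => ?_⟩
    · ext c
      simp [hT, w]
    · have h : e.symm y (e ⟨y, τ y⟩).2 = τ y :=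
        (e.linearEquivAt ℝ y hye).symm_apply_apply (τ y)
      simp [hs.coeff_apply_of_mem hy, h]
  obtain ⟨Λ, hΛ, -⟩ := hL x ⟨hx, hxe⟩
  have hinv : DifferentiableAt ℝ (ContinuousLinearMap.inverse : ((ι → ℝ) →L[ℝ] F) → _)
      (T (w x)) := by
    rw [← hΛ]
    exact (contDiffAt_map_inverse (n := 1) Λ).differentiableAt (by simp)
  have hinv' : MDifferentiableAt 𝓘(ℝ, E) 𝓘(ℝ, F →L[ℝ] (ι → ℝ))
      (fun y => (T (w y)).inverse) x :=
    (hinv.comp (w x) (hTd _)).mdifferentiableAt.comp (f := w) x hw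
  have h := (ContinuousLinearMap.proj (R := ℝ) (φ := fun _ : ι => ℝ) i).differentiableAt.comp_mdifferentiableAt
    (hinv'.clm_apply hτ')
  refine h.congr_of_eventuallyEq ?_
  filter_upwards [hU.mem_nhds hx, e.open_baseSet.mem_nhds hxe] with y hy hye
  obtain ⟨Λ, hΛ, hc⟩ := hL y ⟨hy, hye⟩
  rw [hc]
  change _ = (T (w y)).inverse (e ⟨y, τ y⟩).2 i
  rw [← hΛ, ContinuousLinearMap.inverse_equiv]
  rfl

omit [FiniteDimensional ℝ F] in
/-- A function on a manifold whose derivative vanishes is locally constant. -/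
theorem eventually_eq_of_mvfderiv_eq_zero [IsManifold 𝓘(ℝ, E) 1 M] {g : M → F} {U : Set M} (hU : IsOpen U)
    (hg : ∀ x ∈ U, MDifferentiableAt 𝓘(ℝ, E) 𝓘(ℝ, F) g x)
    (hg' : ∀ x ∈ U, mvfderiv 𝓘(ℝ, E) g x = 0) {x : M} (hx : x ∈ U) :
    ∀ᶠ y in 𝓝 x, g y = g x := by
  set φ := extChartAt 𝓘(ℝ, E) x
  have hopen : IsOpen (φ.target ∩ φ.symm ⁻¹' U) :=
    (continuousOn_extChartAt_symm x).isOpen_inter_preimage (isOpen_extChartAt_target x) hU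
  have hφx : φ x ∈ φ.target ∩ φ.symm ⁻¹' U := ⟨mem_extChartAt_target x, by
    rwa [Set.mem_preimage, extChartAt_to_inv]⟩
  obtain ⟨r, hr, hball⟩ := Metric.isOpen_iff.1 hopen _ hφx
  have hd : ∀ z ∈ Metric.ball (φ x) r, HasFDerivAt (g ∘ φ.symm) (0 : E →L[ℝ] F) z := fun z hz => by
    have hz' := hball hz
    have h1 : MDifferentiableAt 𝓘(ℝ, E) 𝓘(ℝ, E) φ.symm z :=
      ((contMDiffOn_extChartAt_symm (n := 1) x).contMDiffAt
        ((isOpen_extChartAt_target x).mem_nhds hz'.1)).mdifferentiableAt (by simp)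
    have h2 := ((hg _ hz'.2).hasMFDerivAt.comp z h1.hasMFDerivAt).hasFDerivAt
    have h3 : mfderiv 𝓘(ℝ, E) 𝓘(ℝ, F) g (φ.symm z) = 0 := hg' _ hz'.2
    rw [h3, ContinuousLinearMap.zero_comp] at h2
    exact h2
  have hconst : ∀ z ∈ Metric.ball (φ x) r, (g ∘ φ.symm) z = (g ∘ φ.symm) (φ x) := fun z hz =>
    Metric.isOpen_ball.is_const_of_fderiv_eq_zero
      (convex_ball _ _).isPreconnected (fun z hz => (hd z hz).differentiableAt.differentiableWithinAt)
      (fun z hz => (hd z hz).fderiv) hz (Metric.mem_ball_self hr)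
  filter_upwards [(continuousAt_extChartAt (I := 𝓘(ℝ, E)) x).preimage_mem_nhds (Metric.ball_mem_nhds _ hr),
    extChartAt_source_mem_nhds (I := 𝓘(ℝ, E)) x] with y hy hys
  have := hconst _ hy
  rwa [Function.comp_apply, Function.comp_apply, φ.left_inv hys, extChartAt_to_inv] at this

variable [∀ x, IsTopologicalAddGroup (V x)] [∀ x, ContinuousSMul ℝ (V x)]

/-- The coefficients of a parallel section in a parallel frame are locally constant. -/
theorem CovariantDerivative.eventually_coeff_eq [IsManifold 𝓘(ℝ, E) 1 M]
    [ContMDiffVectorBundle 1 F V 𝓘(ℝ, E)] (cov : CovariantDerivative 𝓘(ℝ, E) F V)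
    {ι : Type*} [Fintype ι] {s : ι → Π x : M, V x} {U : Set M}
    (hs : IsLocalFrameOn 𝓘(ℝ, E) F ∞ s U) (hU : IsOpen U) (hcs : ∀ i, ∀ x ∈ U, cov (s i) x = 0)
    {τ : Π x : M, V x}
    (hτ : ∀ x ∈ U, MDifferentiableAt 𝓘(ℝ, E) (𝓘(ℝ, E).prod 𝓘(ℝ, F)) (T% τ) x)
    (hcτ : ∀ x ∈ U, cov τ x = 0) {x : M} (hx : x ∈ U) (i : ι) :
    ∀ᶠ y in 𝓝 x, hs.coeff i y (τ y) = hs.coeff i x (τ x) := by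
  refine eventually_eq_of_mvfderiv_eq_zero (g := fun y => hs.coeff i y (τ y)) hU
    (fun y hy => hs.mdifferentiableAt_coeff hU hy (hτ y hy) i) (fun y hy => ?_) hx
  have hg := fun i (_ : i ∈ Finset.univ) => hs.mdifferentiableAt_coeff hU hy (hτ y hy) i
  have hσ := fun i (_ : i ∈ Finset.univ) =>
    (hs.contMDiffAt hU hy i).mdifferentiableAt (by simp)
  -- Differentiating `τ = ∑ c_i s_i` with all of `τ`, `s_i` parallel leaves `∑ dc_i ⊗ s_i = 0`;
  -- linear independence gives `dc_i = 0`.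
  have h := cov.congr_of_eventuallyEq (MDifferentiableAt.sum_smul_section Finset.univ hg hσ)
    (hs.eventually_eq_sum_coeff_smul τ (hU.mem_nhds hy))
  rw [hcτ y hy, cov.sum_smul Finset.univ hg hσ] at h
  ext v
  have h2 := congrArg (fun A => A v) h
  simp only [hcs _ y hy, smul_zero, zero_add, sum_apply, ContinuousLinearMap.smulRight_apply] at h2
  exact Fintype.linearIndependent_iff.1 (hs.linearIndependent hy) _ h2.symm i

end FrameCoefficients

/-! ### Matrices acting on families of vectors -/

section MatrixAction

variable {n : ℕ} {W W' : Type*} [AddCommGroup W] [Module ℝ W] [AddCommGroup W'] [Module ℝ W']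

/-- The family `i ↦ ∑ j, A i j • v j`. -/
def Matrix.actFamily (A : Matrix (Fin n) (Fin n) ℝ) (v : Fin n → W) (i : Fin n) : W :=
  ∑ j, A i j • v j

/-- With rows as coefficients this is a left action, so successive changes of frame multiply in the
order `t_{αβ} t_{βγ} = t_{αγ}`. -/
theorem Matrix.actFamily_mul (A B : Matrix (Fin n) (Fin n) ℝ) (v : Fin n → W) :
    (A * B).actFamily v = A.actFamily (B.actFamily v) := by
  funext i
  simp only [actFamily, Matrix.mul_apply, Finset.sum_smul, Finset.smul_sum, smul_smul]
  exact Finset.sum_comm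

theorem Matrix.actFamily_one (v : Fin n → W) :
    (1 : Matrix (Fin n) (Fin n) ℝ).actFamily v = v := by
  funext i
  simp [actFamily, Matrix.one_apply]

theorem Matrix.map_actFamily (A : Matrix (Fin n) (Fin n) ℝ) (v : Fin n → W) (f : W →ₗ[ℝ] W') :
    (fun i => f (A.actFamily v i)) = A.actFamily fun i => f (v i) := by
  funext i
  simp [actFamily]

/-- Reduces matrix identities between transition functions to identities between frames. -/
theorem LinearIndependent.actFamily_injective {v : Fin n → W} (hv : LinearIndependent ℝ v) :
    Function.Injective fun A : Matrix (Fin n) (Fin n) ℝ => A.actFamily v := fun A B h => by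
  ext i j
  have h1 : ∑ j, (A i j - B i j) • v j = 0 := by
    simp only [sub_smul, Finset.sum_sub_distrib]
    exact sub_eq_zero.2 (congrFun h i)
  exact sub_eq_zero.1 (Fintype.linearIndependent_iff.1 hv _ h1 j)

theorem Matrix.GeneralLinearGroup.actFamily_inv_eq_iff (g : GL (Fin n) ℝ) {v w : Fin n → W} :
    (g⁻¹.1).actFamily v = w ↔ v = g.1.actFamily w := by
  constructor
  · rintro rfl
    rw [← Matrix.actFamily_mul, g.mul_inv, Matrix.actFamily_one]
  · rintro rfl
    rw [← Matrix.actFamily_mul, g.inv_mul, Matrix.actFamily_one]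

theorem Module.Basis.det_actFamily (b : Module.Basis (Fin n) ℝ W) (A : Matrix (Fin n) (Fin n) ℝ) :
    b.det (A.actFamily b) = A.det := by
  rw [Module.Basis.det_apply, ← Matrix.det_transpose A]
  congr 1
  ext i j
  simp [Module.Basis.toMatrix_apply, Matrix.actFamily, Finsupp.single_apply]

theorem Module.Basis.exists_eq_actFamily (b b' : Module.Basis (Fin n) ℝ W) :
    ∃ g : GL (Fin n) ℝ, (∀ i j, g.1 i j = b'.repr (b i) j) ∧ b = g.1.actFamily b' := by
  set A : Matrix (Fin n) (Fin n) ℝ := Matrix.of fun i j => b'.repr (b i) j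
  have h : (b : Fin n → W) = A.actFamily b' := funext fun i => (b'.sum_repr (b i)).symm
  have hdet : A.det ≠ 0 := by
    rw [← b'.det_actFamily, ← h]
    exact (b'.isUnit_det b).ne_zero
  exact ⟨Matrix.GeneralLinearGroup.mkOfDetNeZero _ hdet, fun _ _ => rfl, h⟩

end MatrixAction

/-! ### Parallel frames and their transition cocycles -/

namespace FlatBundle

open FlatCech Filter Topology

variable {m : ℕ} {M : Type u} [TopologicalSpace M]
  [ChartedSpace (EuclideanSpace ℝ (Fin m)) M] [IsManifold (𝓡 m) ∞ M] {n : ℕ}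
  {E E' : FlatBundle.{u, v} m M n} {s s' : Fin n → Π x : M, E.fiber x} {W W' : Opens M}

instance contMDiffVectorBundle_one (E : FlatBundle.{u, v} m M n) :
    ContMDiffVectorBundle 1 (EuclideanSpace ℝ (Fin n)) E.fiber (𝓡 m) :=
  ContMDiffVectorBundle.of_le (n := ∞) (by simp)

theorem exists_isParallelFrameOn [T2Space M] (E : FlatBundle.{u, v} m M n) (x : M) :
    ∃ U : Opens M, x ∈ U ∧ ∃ s, E.IsParallelFrameOn s U :=
  have := E.smooth
  E.conn.exists_parallel_frame_of_flat E.flat (EuclideanSpace.basisFun (Fin n) ℝ).toBasis x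

theorem IsParallelFrameOn.mono (hs : E.IsParallelFrameOn s W) (h : W' ≤ W) :
    E.IsParallelFrameOn s W' :=
  ⟨hs.1.mono h, fun i x hx => hs.2 i x (h hx)⟩

theorem IsParallelFrameOn.of_forall_exists
    (h : ∀ x ∈ W, ∃ U : Opens M, x ∈ U ∧ E.IsParallelFrameOn s U) : E.IsParallelFrameOn s W := by
  refine ⟨⟨fun {x} hx => ?_, fun {x} hx => ?_, fun i x hx => ?_⟩, fun i x hx => ?_⟩ <;>
    obtain ⟨U, hxU, hU⟩ := h x hx
  · exact hU.1.linearIndependent hxU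
  · exact hU.1.generating hxU
  · exact (hU.1.contMDiffAt U.isOpen hxU i).contMDiffWithinAt
  · exact hU.2 i x hxU

theorem IsParallelFrameOn.mdifferentiableAt (hs : E.IsParallelFrameOn s W) {x : M} (hx : x ∈ W)
    (i : Fin n) : MDifferentiableAt (𝓡 m) ((𝓡 m).prod 𝓘(ℝ, EuclideanSpace ℝ (Fin n)))
      (E.toTotal (s i)) x :=
  (hs.1.contMDiffAt W.isOpen hx i).mdifferentiableAt (by simp)

/-- Two parallel frames differ by a locally constant function with values in `GL(n, ℝ)`. -/
theorem IsParallelFrameOn.exists_transition (hs : E.IsParallelFrameOn s W)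
    (hs' : E.IsParallelFrameOn s' W) :
    ∃ t : Sec n W, ∀ x : W, (fun i => s i x) = (t x).1.actFamily fun i => s' i x := by
  choose g hg hgs using fun x : W =>
    (hs.1.toBasisAt x.2).exists_eq_actFamily (hs'.1.toBasisAt x.2)
  have hcoe : ∀ x : W, (fun i => s i x) = (g x).1.actFamily fun i => s' i x := fun x => by
    simpa [funext_iff, Matrix.actFamily] using hgs x
  refine ⟨⟨g, (IsLocallyConstant.iff_eventually_eq g).2 fun x => ?_⟩, hcoe⟩
  -- The entries of `g` are coefficients of parallel sections in a parallel frame. There are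
  -- finitely many, so all are constant on one neighbourhood.
  have h : ∀ i j, ∀ᶠ y : W in 𝓝 x, hs'.1.coeff j y (s i y) = hs'.1.coeff j x (s i x) := fun i j =>
    continuous_subtype_val.continuousAt.eventually
      (E.conn.eventually_coeff_eq hs'.1 W.isOpen hs'.2 (fun y hy => hs.mdifferentiableAt hy i)
        (hs.2 i) x.2 j)
  filter_upwards [eventually_all.2 fun i => eventually_all.2 (h i)] with y hy
  ext i j
  simpa [hg, y.2, x.2] using hy i j

/-- A locally constant linear change of a parallel frame is a parallel frame. -/
theorem IsParallelFrameOn.of_actFamily (hs : E.IsParallelFrameOn s W) (b : Sec n W)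
    (h : ∀ x : W, (fun i => s' i x) = (b x).1.actFamily fun i => s i x) :
    E.IsParallelFrameOn s' W := by
  -- Freezing `b` at `x` makes `s'` a constant combination of `s` near `x`, so smoothness and
  -- parallelism pass from `s` to `s'`.
  have hloc : ∀ x (hx : x ∈ W) (i : Fin n),
      ∀ᶠ y in 𝓝 x, s' i y = ∑ j, (b ⟨x, hx⟩).1 i j • s j y := fun x hx i => by
    have h1 := (IsLocallyConstant.iff_eventually_eq b).1 b.isLocallyConstant ⟨x, hx⟩
    rw [nhds_subtype_eq_comap, eventually_comap] at h1
    filter_upwards [h1, W.isOpen.mem_nhds hx] with y hy hyW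
    rw [← hy ⟨y, hyW⟩ rfl]
    exact congrFun (h ⟨y, hyW⟩) i
  have hB : ∀ x (hx : x ∈ W), LinearIndependent ℝ (fun i => s' i x) ∧
      Submodule.span ℝ (Set.range fun i => s' i x) = ⊤ := fun x hx => by
    have h1 : (fun i => s i x) = hs.1.toBasisAt hx := funext fun i => by simp
    rw [Module.Basis.is_basis_iff_det (hs.1.toBasisAt hx), h ⟨x, hx⟩, h1,
      Module.Basis.det_actFamily]
    exact (Matrix.isUnit_iff_isUnit_det _).1 (b ⟨x, hx⟩).isUnit
  refine ⟨⟨fun {x} hx => (hB x hx).1, fun {x} hx => (hB x hx).2.ge, fun i x hx => ?_⟩,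
    fun i x hx => ?_⟩
  · refine ContMDiffAt.contMDiffWithinAt ?_
    refine ContMDiffAt.congr_of_eventuallyEq (ContMDiffAt.sum_section (s := Finset.univ)
      fun j _ => (hs.1.contMDiffAt W.isOpen hx j).const_smul_section (a := (b ⟨x, hx⟩).1 i j)) ?_
    filter_upwards [hloc x hx i] with y hy
    rw [hy]
    rfl
  · have hc : ∀ j ∈ Finset.univ, MDifferentiableAt (𝓡 m) 𝓘(ℝ, ℝ)
        (fun _ : M => (b ⟨x, hx⟩).1 i j) x := fun j _ => mdifferentiableAt_const
    rw [E.conn.congr_of_eventuallyEq (MDifferentiableAt.sum_smul_section Finset.univ hc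
      fun j _ => hs.mdifferentiableAt hx j) (hloc x hx i),
      E.conn.sum_smul Finset.univ hc fun j _ => hs.mdifferentiableAt hx j]
    refine Finset.sum_eq_zero fun j _ => ?_
    rw [hs.2 j x hx, smul_zero, zero_add]
    ext v
    simp [mvfderiv]

/-- Transports frames to one bundle, so that data on isomorphic representatives can be compared. -/
theorem Iso.isParallelFrameOn (φ : Iso E E') (hs : E.IsParallelFrameOn s W) :
    E'.IsParallelFrameOn (fun i x => φ.equiv x (s i x)) W := by
  refine ⟨⟨fun {x} hx => ?_, fun {x} hx => ?_, fun i => ?_⟩, fun i x hx => ?_⟩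
  · exact (hs.1.linearIndependent hx).map' _ (φ.equiv x).ker
  · have h := ((hs.1.toBasisAt hx).map (φ.equiv x)).span_eq.ge
    simpa [Function.comp_def, Module.Basis.coe_map] using h
  · exact φ.smooth_toFun.comp_contMDiffOn (hs.1.contMDiffOn i)
  · ext v
    rw [φ.map_conn (s i) x (hs.mdifferentiableAt hx i) v, hs.2 i x hx]
    simp

theorem isTransitionCocycle_iff {𝒰 : OpenCover M} {h : 𝒰.A → Fin n → Π x : M, E.fiber x}
    {t : Z1 𝒰 n} : E.IsTransitionCocycle 𝒰 h t ↔ (∀ α, E.IsParallelFrameOn (h α) (𝒰.U α)) ∧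
      ∀ (α β : 𝒰.A) (x : M) (hα : x ∈ 𝒰.U α) (hβ : x ∈ 𝒰.U β),
        (fun i => h α i x) = (t.1 α β ⟨x, hα, hβ⟩).1.actFamily fun i => h β i x :=
  ⟨fun ht => ⟨ht.1, fun α β x hα hβ => funext (ht.2 α β x hα hβ)⟩,
    fun ht => ⟨ht.1, fun α β x hα hβ i => congrFun (ht.2 α β x hα hβ) i⟩⟩

/-- Parallel frames over the members of an open cover have a transition cocycle. -/
theorem exists_isTransitionCocycle {𝒰 : OpenCover M} {h : 𝒰.A → Fin n → Π x : M, E.fiber x}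
    (hh : ∀ α, E.IsParallelFrameOn (h α) (𝒰.U α)) : ∃ t, E.IsTransitionCocycle 𝒰 h t := by
  choose t ht using fun α β => ((hh α).mono (inf_le_left : 𝒰.U α ⊓ 𝒰.U β ≤ _)).exists_transition
    ((hh β).mono inf_le_right)
  refine ⟨⟨t, (d1_eq_one_iff t).2 fun α β γ x hα hβ hγ => Units.ext ?_⟩,
    isTransitionCocycle_iff.2 ⟨hh, fun α β x hα hβ => ht α β ⟨x, hα, hβ⟩⟩⟩
  refine ((hh γ).1.linearIndependent hγ).actFamily_injective ?_
  change (_ * _ : Matrix _ _ ℝ).actFamily _ = _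
  rw [Matrix.actFamily_mul, ← ht β γ ⟨x, hβ, hγ⟩, ← ht α β ⟨x, hα, hβ⟩]
  exact ht α γ ⟨x, hα, hγ⟩

/-- The class of a transition cocycle only depends on the isomorphism class of the bundle. -/
theorem IsTransitionCocycle.mk_eq_mk (φ : Iso E E') {𝒰 𝒰' : OpenCover M}
    {h : 𝒰.A → Fin n → Π x : M, E.fiber x} {t : Z1 𝒰 n} (ht : E.IsTransitionCocycle 𝒰 h t)
    {h' : 𝒰'.A → Fin n → Π x : M, E'.fiber x} {t' : Z1 𝒰' n}
    (ht' : E'.IsTransitionCocycle 𝒰' h' t') : H1.mk 𝒰 t = H1.mk 𝒰' t' := by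
  rw [isTransitionCocycle_iff] at ht ht'
  -- On the common refinement, `b` expresses the image under `φ` of the first frame in terms of the
  -- second; it is the cochain showing the pulled-back cocycles cohomologous.
  choose b hb using fun p : 𝒰.A × 𝒰'.A =>
    ((φ.isParallelFrameOn (ht.1 p.1)).mono
      (inf_le_left : 𝒰.U p.1 ⊓ 𝒰'.U p.2 ≤ _)).exists_transition ((ht'.1 p.2).mono inf_le_right)
  refine Quotient.sound ⟨𝒰.inf 𝒰', 𝒰.infLeft 𝒰', 𝒰.infRight 𝒰', Quotient.sound
    ((cohomologous_iff _ _).2 ⟨b, fun p q x hp hq => Units.ext ?_⟩)⟩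
  refine ((ht'.1 q.2).1.linearIndependent hq.2).actFamily_injective ?_
  have h1 := hb p ⟨x, hp⟩
  have h2 := hb q ⟨x, hq⟩
  have h3 := congrArg (fun w i => φ.equiv x (w i)) (ht.2 p.1 q.1 x hp.1 hq.1)
  have h4 := ht'.2 p.2 q.2 x hp.2 hq.2
  change (t'.1 p.2 q.2 ⟨x, hp.2, hq.2⟩).1.actFamily _ =
    ((b p ⟨x, hp⟩)⁻¹.1 * (t.1 p.1 q.1 ⟨x, hp.1, hq.1⟩).1 * (b q ⟨x, hq⟩).1).actFamily _
  have h5 := Matrix.map_actFamily (t.1 p.1 q.1 ⟨x, hp.1, hq.1⟩).1 (fun i => h q.1 i x)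
    (φ.equiv x).toLinearMap
  rw [← h4, Matrix.actFamily_mul, ← h2, Matrix.actFamily_mul]
  refine ((Matrix.GeneralLinearGroup.actFamily_inv_eq_iff _).2 ?_).symm
  rw [← h1]
  exact (h3.trans h5).symm

/-- A bundle whose transition cocycle is cohomologous to `1` after a refinement has a global
parallel frame. -/
theorem IsTransitionCocycle.exists_global_frame {𝒰 : OpenCover M}
    {h : 𝒰.A → Fin n → Π x : M, E.fiber x} {t : Z1 𝒰 n} (ht : E.IsTransitionCocycle 𝒰 h t)
    (h1 : H1.mk 𝒰 t = 1) : ∃ s, E.IsParallelFrameOn s ⊤ := by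
  rw [isTransitionCocycle_iff] at ht
  obtain ⟨𝒱, r, r', hr⟩ := Quotient.exact h1
  obtain ⟨b, hb⟩ := (cohomologous_iff _ _).1 (Quotient.exact hr)
  choose a ha using 𝒱.covers
  -- The corrected frames `b_α⁻¹ h_{ρ(α)}` agree on overlaps: `h_{ρ(α)} = t h_{ρ(β)}`, and `1 =
  -- b_α⁻¹ t b_β` gives `b_α⁻¹ t = b_β⁻¹`.
  let f : ∀ α x, x ∈ 𝒱.U α → Fin n → E.fiber x := fun α x hx =>
    ((b α ⟨x, hx⟩)⁻¹.1).actFamily fun i => h (r.ρ α) i x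
  have hf : ∀ α β x (hα : x ∈ 𝒱.U α) (hβ : x ∈ 𝒱.U β), f α x hα = f β x hβ :=
      fun α β x hα hβ => by
    have h2 : (1 : GL (Fin n) ℝ) = (b α ⟨x, hα⟩)⁻¹ *
      t.1 (r.ρ α) (r.ρ β) ⟨x, r.le α hα, r.le β hβ⟩ * b β ⟨x, hβ⟩ := hb α β x hα hβ
    have h3 := congrArg Units.val (eq_inv_of_mul_eq_one_left h2.symm)
    simp only [f]
    rw [ht.2 _ _ x (r.le α hα) (r.le β hβ), ← Matrix.actFamily_mul, ← h3]
    rfl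
  -- The index `a y` may jump with `y`, but on `𝒱.U (a x)` the agreement on overlaps lets the fixed
  -- index `a x` be used instead.
  refine ⟨fun i x => f (a x) x (ha x) i, IsParallelFrameOn.of_forall_exists fun x _ =>
    ⟨𝒱.U (a x), ha x, ((ht.1 _).mono (r.le (a x))).of_actFamily (b (a x))⁻¹ fun y => ?_⟩⟩
  exact hf _ _ _ _ _

end FlatBundle

end

theorem proposition2 {m : ℕ} {M : Type u} [TopologicalSpace M] [T2Space M]
    [SecondCountableTopology M] [ChartedSpace (EuclideanSpace ℝ (Fin m)) M]
    [IsManifold (𝓡 m) ∞ M] {n : ℕ} (E : FlatBundle.{u, v} m M n) :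
    E.isoClass.transitionClasses = {E.isoClass.Θ} ∧
      ((∃ s : Fin n → Π x : M, E.fiber x, E.IsParallelFrameOn s ⊤) ↔ E.isoClass.Θ = 1) := by
  -- The cover is indexed by the points of `M`, one local parallel frame around each.
  choose U hU s hs using E.exists_isParallelFrameOn
  obtain ⟨t, ht⟩ := FlatBundle.exists_isTransitionCocycle (𝒰 := ⟨M, U, fun x => ⟨x, hU x⟩⟩) hs
  have hunique : ∀ c ∈ E.isoClass.transitionClasses, c = FlatCech.H1.mk _ t := by
    rintro c ⟨E', 𝒰, h, t', hE, ht', rfl⟩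
    obtain ⟨φ⟩ := Quotient.exact hE
    exact ht'.mk_eq_mk φ ht
  -- The cocycle `t` shows that the set of classes is nonempty, so the choice in `Θ` lies in it;
  -- uniqueness then identifies it.
  have hΘ : E.isoClass.Θ = FlatCech.H1.mk _ t :=
    hunique _ (Classical.epsilon_spec (p := fun c => c ∈ E.isoClass.transitionClasses)
      ⟨_, E, _, _, t, rfl, ht, rfl⟩)
  refine ⟨?_, ?_⟩
  · ext c
    rw [Set.mem_singleton_iff, hΘ]
    refine ⟨hunique c, ?_⟩
    rintro rfl
    exact ⟨E, _, _, t, rfl, ht, rfl⟩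
  · rw [hΘ]
    refine ⟨?_, ht.exists_global_frame⟩
    rintro ⟨σ, hσ⟩
    -- On the one-member cover a global parallel frame has the identity as transition cocycle, so
    -- `1` is among the classes.
    refine (hunique 1 ⟨E, FlatCech.OpenCover.trivial M, fun _ => σ, 1, rfl, FlatBundle.isTransitionCocycle_iff.2
      ⟨fun _ => hσ, fun _ _ x _ _ => ?_⟩, rfl⟩).symm
    exact (Matrix.actFamily_one _).symm
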